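/- Let $0<\alpha<1$. There exists a function $f\in C^{1+\alpha}[0,1]$, that is, a differentiable function $f:[0,1]\to\mathbb R$ (one-sidedly differentiable at the endpoints) whose derivative satisfies $$\sup\Big\{\frac{|f'(x)-f'(y)|}{|x-y|^{\alpha}} : x,y\in[0,1],\ x\neq y\Big\}<\infty ,$$ such that for every set $A\subseteq[0,1]$ whose upper Minkowski (box) dimension is greater than $\alpha$ the restriction $f|_A$ is neither convex nor concave. Here, for an integer $N\ge 2$ (the value does not depend on the choice of $N$), the upper Minkowski dimension of a nonempty set $A\subseteq[0,1]$ is $$\limsup_{k\to\infty}\frac{\log \#\{j\in\mathbb Z : A\cap[(j-1)N^{-k},\,jN^{-k}]\neq\emptyset\}}{k\log N},$$ and the empty set has dimension $0$. The restriction $f|_A$ is called convex if $$f(y)\le \frac{z-y}{z-x}f(x)+\frac{y-x}{z-x}f(z)\qquad\text{for all } x<y<z \text{ in } A,$$ and concave if the reverse inequality holds for all such $x,y,z$. -/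

import Mathlib

open Set Filter

/-- `g` belongs to the Hölder class `C^γ[0,1]`, `0 < γ < 1`: the supremum of
`|g x - g y| / |x - y| ^ γ` over distinct `x, y ∈ [0,1]` is finite. -/
def HolderOnUnit (γ : ℝ) (g : ℝ → ℝ) : Prop :=
  ∃ C : ℝ, ∀ x ∈ Icc (0 : ℝ) 1, ∀ y ∈ Icc (0 : ℝ) 1, x ≠ y → |g x - g y| / |x - y| ^ γ ≤ C

/-- `f` belongs to the class `C^β[0,1]`, `1 < β < 2`: it is differentiable on `[0,1]` (one-sidedly
at the endpoints) and its derivative belongs to `C^(β-1)[0,1]`. Only the values of `f` on `[0,1]`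
matter. -/
def DifferentiableHolderUnit (β : ℝ) (f : ℝ → ℝ) : Prop :=
  DifferentiableOn ℝ f (Icc 0 1) ∧ HolderOnUnit (β - 1) (derivWithin f (Icc 0 1))

/-- The number of closed grid intervals `[(j-1)/N^k, j/N^k]`, `j ∈ ℤ`, which meet `A`
(for bounded `A` and `N ≥ 1` this number is finite). -/
noncomputable def gridCount (N k : ℕ) (A : Set ℝ) : ℕ :=
  {j : ℤ | (A ∩ Icc (((j : ℝ) - 1) / (N : ℝ) ^ k) ((j : ℝ) / (N : ℝ) ^ k)).Nonempty}.ncard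

/-- The upper Minkowski (box) dimension of a bounded set `A ⊆ ℝ`, computed along the grids of mesh
`N^(-k)`, where `N ≥ 2` (the value does not depend on `N`). The empty set has dimension `0`. -/
noncomputable def upperMinkowskiDim (N : ℕ) (A : Set ℝ) : EReal :=
  limsup (fun k : ℕ => ((Real.log (gridCount N k A) / (k * Real.log N) : ℝ) : EReal)) atTop

/-- The restriction of `f` to an arbitrary set `A ⊆ ℝ` is convex: the graph of `f` at any point
of `A` lies on or below the chord over any two points of `A` surrounding it. -/
def RestrictionConvex (f : ℝ → ℝ) (A : Set ℝ) : Prop :=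
  ∀ x ∈ A, ∀ y ∈ A, ∀ z ∈ A, x < y → y < z →
    f y ≤ (z - y) / (z - x) * f x + (y - x) / (z - x) * f z

/-- The restriction of `f` to an arbitrary set `A ⊆ ℝ` is concave. -/
def RestrictionConcave (f : ℝ → ℝ) (A : Set ℝ) : Prop :=
  ∀ x ∈ A, ∀ y ∈ A, ∀ z ∈ A, x < y → y < z →
    (z - y) / (z - x) * f x + (y - x) / (z - x) * f z ≤ f y

/-- The quadratic cardinal B-spline supported on `[-1, 2]`. -/
noncomputable def bspl (t : ℝ) : ℝ :=
  (max (t + 1) 0) ^ 2 / 2 - 3 / 2 * (max t 0) ^ 2 + 3 / 2 * (max (t - 1) 0) ^ 2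
    - (max (t - 2) 0) ^ 2 / 2

/-- The derivative of `bspl`. -/
noncomputable def bsplDeriv (t : ℝ) : ℝ :=
  max (t + 1) 0 - 3 * max t 0 + 3 * max (t - 1) 0 - max (t - 2) 0

lemma hasDerivAt_max_zero_sq (x : ℝ) : HasDerivAt (fun t : ℝ => (max t 0) ^ 2) (2 * max x 0) x := by
  rcases lt_trichotomy x 0 with h | h | h
  · have : (fun t : ℝ => (max t 0) ^ 2) =ᶠ[nhds x] fun _ => 0 := by
      filter_upwards [Iio_mem_nhds h] with t ht
      simp [max_eq_right (le_of_lt (show t < 0 from ht))]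
    rw [max_eq_right h.le]
    simpa using (hasDerivAt_const x (0 : ℝ)).congr_of_eventuallyEq this
  · subst h
    rw [hasDerivAt_iff_isLittleO]
    simp only [max_self, ne_eq, OfNat.ofNat_ne_zero, not_false_eq_true, zero_pow, sub_zero,
      mul_zero, smul_zero]
    refine Asymptotics.IsBigO.trans_isLittleO (g := fun t : ℝ => t ^ 2) ?_ ?_
    · refine Asymptotics.IsBigO.of_bound 1 (Eventually.of_forall fun t => ?_)
      rw [one_mul, norm_pow, norm_pow]
      refine pow_le_pow_left₀ (norm_nonneg _) ?_ 2
      rw [Real.norm_eq_abs, Real.norm_eq_abs, abs_of_nonneg (le_max_right _ _)]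
      exact max_le (le_abs_self _) (abs_nonneg _)
    · simpa using Asymptotics.isLittleO_pow_pow (𝕜 := ℝ) (show 1 < 2 by norm_num)
  · have : (fun t : ℝ => (max t 0) ^ 2) =ᶠ[nhds x] fun t => t ^ 2 := by
      filter_upwards [Ioi_mem_nhds h] with t ht
      rw [max_eq_left (le_of_lt (show 0 < t from ht))]
    rw [max_eq_left h.le]
    simpa using (hasDerivAt_pow 2 x).congr_of_eventuallyEq this

lemma hasDerivAt_bspl (x : ℝ) : HasDerivAt bspl (bsplDeriv x) x := by
  have h1 : HasDerivAt (fun t : ℝ => (max (t + 1) 0) ^ 2) (2 * max (x + 1) 0) x :=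
    (hasDerivAt_max_zero_sq (x + 1)).comp_add_const x 1
  have h2 := hasDerivAt_max_zero_sq x
  have h3 : HasDerivAt (fun t : ℝ => (max (t - 1) 0) ^ 2) (2 * max (x - 1) 0) x :=
    (hasDerivAt_max_zero_sq (x - 1)).comp_sub_const x 1
  have h4 : HasDerivAt (fun t : ℝ => (max (t - 2) 0) ^ 2) (2 * max (x - 2) 0) x :=
    (hasDerivAt_max_zero_sq (x - 2)).comp_sub_const x 2
  refine ((((h1.div_const 2).sub (h2.const_mul (3 / 2))).add (h3.const_mul (3 / 2))).sub
    (h4.div_const 2)).congr_deriv ?_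
  unfold bsplDeriv; ring

lemma bspl_eq_zero {t : ℝ} (h : t ≤ -1 ∨ 2 ≤ t) : bspl t = 0 := by
  unfold bspl
  rcases h with h | h
  · rw [max_eq_right, max_eq_right, max_eq_right, max_eq_right] <;> linarith
  · rw [max_eq_left, max_eq_left, max_eq_left, max_eq_left] <;> linarith

lemma bsplDeriv_eq_zero {t : ℝ} (h : t ≤ -1 ∨ 2 ≤ t) : bsplDeriv t = 0 := by
  unfold bsplDeriv
  rcases h with h | h
  · rw [max_eq_right, max_eq_right, max_eq_right, max_eq_right] <;> linarith
  · rw [max_eq_left, max_eq_left, max_eq_left, max_eq_left] <;> linarith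

lemma bspl_left {t : ℝ} (h0 : -1 ≤ t) (h1 : t ≤ 0) : bspl t = (t + 1) ^ 2 / 2 := by
  unfold bspl
  rw [max_eq_left (by linarith), max_eq_right h1, max_eq_right (by linarith),
    max_eq_right (by linarith)]
  ring

lemma bspl_mid {t : ℝ} (h0 : 0 ≤ t) (h1 : t ≤ 1) : bspl t = 1 / 2 + t - t ^ 2 := by
  unfold bspl
  rw [max_eq_left (by linarith), max_eq_left h0, max_eq_right (by linarith),
    max_eq_right (by linarith)]
  ring

lemma bspl_right {t : ℝ} (h0 : 1 ≤ t) (h1 : t ≤ 2) : bspl t = (2 - t) ^ 2 / 2 := by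
  unfold bspl
  rw [max_eq_left (by linarith), max_eq_left (by linarith), max_eq_left (by linarith),
    max_eq_right (by linarith)]
  ring

lemma half_le_bspl {t : ℝ} (h0 : 0 ≤ t) (h1 : t ≤ 1) : 1 / 2 ≤ bspl t := by
  rw [bspl_mid h0 h1]; nlinarith

lemma abs_bspl_le (t : ℝ) : |bspl t| ≤ 1 := by
  rcases le_or_gt t (-1) with h | h
  · simp [bspl_eq_zero (Or.inl h)]
  rcases le_or_gt t 0 with h' | h'
  · rw [bspl_left h.le h', abs_le]; constructor <;> nlinarith
  rcases le_or_gt t 1 with h'' | h''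
  · rw [bspl_mid h'.le h'', abs_le]; constructor <;> nlinarith
  rcases le_or_gt t 2 with h3 | h3
  · rw [bspl_right h''.le h3, abs_le]; constructor <;> nlinarith
  · simp [bspl_eq_zero (Or.inr h3.le)]

lemma abs_bsplDeriv_le (t : ℝ) : |bsplDeriv t| ≤ 1 := by
  rcases le_or_gt t (-1) with h | h
  · simp [bsplDeriv_eq_zero (Or.inl h)]
  rcases le_or_gt 2 t with h' | h'
  · simp [bsplDeriv_eq_zero (Or.inr h')]
  unfold bsplDeriv
  rw [max_eq_left (by linarith : (0:ℝ) ≤ t + 1), max_eq_right (by linarith : t - 2 ≤ 0), abs_le]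
  rcases le_total t 0 with h1 | h1 <;> rcases le_total t 1 with h2 | h2 <;>
  [rw [max_eq_right h1, max_eq_right (by linarith : t - 1 ≤ 0)];
   exact absurd h1 (by linarith);
   rw [max_eq_left h1, max_eq_right (by linarith : t - 1 ≤ 0)];
   rw [max_eq_left h1, max_eq_left (by linarith : 0 ≤ t - 1)]] <;> constructor <;> linarith

lemma abs_max_zero_sub_le (x y : ℝ) : |max x 0 - max y 0| ≤ |x - y| := by
  simpa using abs_max_sub_max_le_abs x y 0

lemma abs_bsplDeriv_sub_le (x y : ℝ) : |bsplDeriv x - bsplDeriv y| ≤ 8 * |x - y| := by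
  have h1 := abs_max_zero_sub_le (x + 1) (y + 1)
  have h2 := abs_max_zero_sub_le x y
  have h3 := abs_max_zero_sub_le (x - 1) (y - 1)
  have h4 := abs_max_zero_sub_le (x - 2) (y - 2)
  rw [add_sub_add_right_eq_sub] at h1
  rw [sub_sub_sub_cancel_right] at h3 h4
  rw [abs_le] at *
  unfold bsplDeriv
  constructor <;> linarith [h1.1, h1.2, h2.1, h2.2, h3.1, h3.2, h4.1, h4.2]

/-- The quadratic spline on the integer knots with coefficients `c j`, `-1 ≤ j ≤ K`. -/
noncomputable def spline (K : ℕ) (c : ℤ → ℝ) (y : ℝ) : ℝ :=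
  ∑ j ∈ Finset.Icc (-1 : ℤ) K, c j * bspl (y - j)

/-- The derivative of `spline`. -/
noncomputable def splineDeriv (K : ℕ) (c : ℤ → ℝ) (y : ℝ) : ℝ :=
  ∑ j ∈ Finset.Icc (-1 : ℤ) K, c j * bsplDeriv (y - j)

lemma hasDerivAt_spline (K : ℕ) (c : ℤ → ℝ) (y : ℝ) :
    HasDerivAt (spline K c) (splineDeriv K c y) y := by
  unfold spline splineDeriv
  refine HasDerivAt.fun_sum fun j _ => ?_
  exact ((hasDerivAt_bspl (y - j)).comp_sub_const y (j : ℝ)).const_mul (c j)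

lemma mem_window {y : ℝ} {j : ℤ} (h1 : -1 < y - j) (h2 : y - j < 2) :
    j ∈ Finset.Icc (⌊y⌋ - 1) (⌊y⌋ + 1) := by
  rw [Finset.mem_Icc]
  have := Int.floor_le y
  have := Int.lt_floor_add_one y
  constructor
  · have : ((⌊y⌋ : ℤ) : ℝ) - 2 < j := by linarith
    have : (⌊y⌋ - 2 : ℤ) < j := by exact_mod_cast this
    omega
  · have : (j : ℝ) < ⌊y⌋ + 2 := by linarith
    have : j < (⌊y⌋ + 2 : ℤ) := by exact_mod_cast this
    omega

lemma abs_sum_window_le {s w : Finset ℤ} {g : ℤ → ℝ} {B : ℝ}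
    (hg : ∀ j, |g j| ≤ B) (hw : ∀ j, j ∉ w → g j = 0) :
    |∑ j ∈ s, g j| ≤ w.card * B := by
  have hB : 0 ≤ B := (abs_nonneg _).trans (hg 0)
  calc |∑ j ∈ s, g j| = |∑ j ∈ s ∩ w, g j| := by
        congr 1
        symm
        refine Finset.sum_subset Finset.inter_subset_left fun j hj hj' => hw j fun h => hj' ?_
        exact Finset.mem_inter.2 ⟨hj, h⟩
    _ ≤ ∑ j ∈ s ∩ w, |g j| := Finset.abs_sum_le_sum_abs _ _
    _ ≤ (s ∩ w).card * B := by
        simpa using Finset.sum_le_card_nsmul _ _ B fun j _ => hg j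
    _ ≤ w.card * B := by
        gcongr
        exact Finset.inter_subset_right

lemma card_window (a : ℤ) : (Finset.Icc (a - 1) (a + 1)).card = 3 := by
  rw [Int.card_Icc]; omega

section
variable {c : ℤ → ℝ}

lemma abs_spline_le (hc : ∀ j, |c j| ≤ 1) (K : ℕ) (y : ℝ) : |spline K c y| ≤ 3 := by
  have := abs_sum_window_le (s := Finset.Icc (-1 : ℤ) K) (w := Finset.Icc (⌊y⌋ - 1) (⌊y⌋ + 1))
    (g := fun j : ℤ => c j * bspl (y - j)) (B := 1)
    (fun j => by
      rw [abs_mul]; exact mul_le_one₀ (hc j) (abs_nonneg _) (abs_bspl_le _))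
    (fun j hj => by
      rw [bspl_eq_zero, mul_zero]
      by_contra! h
      exact hj (mem_window h.1 h.2))
  rw [card_window] at this
  simpa [spline] using this

lemma abs_splineDeriv_le (hc : ∀ j, |c j| ≤ 1) (K : ℕ) (y : ℝ) : |splineDeriv K c y| ≤ 3 := by
  have := abs_sum_window_le (s := Finset.Icc (-1 : ℤ) K) (w := Finset.Icc (⌊y⌋ - 1) (⌊y⌋ + 1))
    (g := fun j : ℤ => c j * bsplDeriv (y - j)) (B := 1)
    (fun j => by
      rw [abs_mul]; exact mul_le_one₀ (hc j) (abs_nonneg _) (abs_bsplDeriv_le _))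
    (fun j hj => by
      rw [bsplDeriv_eq_zero, mul_zero]
      by_contra! h
      exact hj (mem_window h.1 h.2))
  rw [card_window] at this
  simpa [splineDeriv] using this

lemma abs_splineDeriv_sub_le (hc : ∀ j, |c j| ≤ 1) (K : ℕ) (y z : ℝ) :
    |splineDeriv K c y - splineDeriv K c z| ≤ 48 * |y - z| := by
  have := abs_sum_window_le (s := Finset.Icc (-1 : ℤ) K)
    (w := Finset.Icc (⌊y⌋ - 1) (⌊y⌋ + 1) ∪ Finset.Icc (⌊z⌋ - 1) (⌊z⌋ + 1))
    (g := fun j : ℤ => c j * bsplDeriv (y - j) - c j * bsplDeriv (z - j)) (B := 8 * |y - z|)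
    (fun j => by
      rw [← mul_sub, abs_mul]
      calc |c j| * |bsplDeriv (y - j) - bsplDeriv (z - j)| ≤ 1 * (8 * |(y - j) - (z - j)|) :=
            mul_le_mul (hc j) (abs_bsplDeriv_sub_le _ _) (abs_nonneg _) zero_le_one
        _ = 8 * |y - z| := by rw [one_mul, sub_sub_sub_cancel_right])
    (fun j hj => by
      rw [Finset.mem_union, not_or] at hj
      rw [bsplDeriv_eq_zero, bsplDeriv_eq_zero, sub_self]
      · by_contra! h
        exact hj.2 (mem_window h.1 h.2)
      · by_contra! h
        exact hj.1 (mem_window h.1 h.2))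
  rw [Finset.sum_sub_distrib] at this
  refine this.trans ?_
  have hcard : ((Finset.Icc (⌊y⌋ - 1) (⌊y⌋ + 1) ∪ Finset.Icc (⌊z⌋ - 1) (⌊z⌋ + 1)).card : ℝ) ≤ 6 := by
    have := Finset.card_union_le (Finset.Icc (⌊y⌋ - 1) (⌊y⌋ + 1)) (Finset.Icc (⌊z⌋ - 1) (⌊z⌋ + 1))
    rw [card_window, card_window] at this
    exact_mod_cast this
  nlinarith [abs_nonneg (y - z)]

end

lemma spline_eq_three {K : ℕ} {c : ℤ → ℝ} {a : ℤ} {y : ℝ} (ha : 0 ≤ a) (haK : a < K)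
    (h0 : (a : ℝ) ≤ y) (h1 : y ≤ a + 1) :
    spline K c y = c (a - 1) * bspl (y - a + 1) + c a * bspl (y - a)
      + c (a + 1) * bspl (y - a - 1) := by
  unfold spline
  have hsub : ({a - 1, a, a + 1} : Finset ℤ) ⊆ Finset.Icc (-1 : ℤ) K := by
    intro j hj
    simp only [Finset.mem_insert, Finset.mem_singleton] at hj
    rw [Finset.mem_Icc]; omega
  rw [← Finset.sum_subset hsub]
  · rw [Finset.sum_insert, Finset.sum_insert, Finset.sum_singleton]
    · push_cast
      rw [show y - (a - 1 : ℝ) = y - a + 1 by ring, show y - (a + 1 : ℝ) = y - a - 1 by ring]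
      ring
    · simp
    · simp only [Finset.mem_insert, Finset.mem_singleton]; omega
  · intro j _ hj
    simp only [Finset.mem_insert, Finset.mem_singleton, not_or] at hj
    rw [bspl_eq_zero, mul_zero]
    rcases lt_or_ge j (a - 1) with h | h
    · right
      have : (j : ℝ) ≤ a - 2 := by exact_mod_cast (by omega : j ≤ a - 2)
      linarith
    · left
      have : (a : ℝ) + 2 ≤ j := by exact_mod_cast (by omega : a + 2 ≤ j)
      linarith

lemma exists_quadratic_spline {K : ℕ} {c : ℤ → ℝ} (hc : ∀ j, c j ∈ Icc (0 : ℝ) 1) {a : ℤ}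
    (ha : 0 ≤ a) (haK : a < K) :
    ∃ p₀ p₁ p₂ : ℝ, |p₂| ≤ 1 ∧ ∀ y : ℝ, (a : ℝ) ≤ y → y ≤ a + 1 →
      spline K c y = p₀ + p₁ * y + p₂ * y ^ 2 := by
  have h1 := hc (a - 1)
  have h2 := hc a
  have h3 := hc (a + 1)
  refine ⟨c (a - 1) * ((1 + a) ^ 2 / 2) + c a * (1 / 2 - a - a ^ 2) + c (a + 1) * (a ^ 2 / 2),
    c (a - 1) * (-(1 + a)) + c a * (1 + 2 * a) + c (a + 1) * (-a),
    c (a - 1) / 2 - c a + c (a + 1) / 2, ?_, ?_⟩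
  · rw [abs_le]; constructor <;> linarith [h1.1, h1.2, h2.1, h2.2, h3.1, h3.2]
  · intro y hy hy'
    rw [spline_eq_three ha haK hy hy', bspl_right (by linarith) (by linarith),
      bspl_mid (by linarith) (by linarith), bspl_left (by linarith) (by linarith)]
    ring

open scoped Classical in
/-- Events `Bad s`, `s ∈ S`, on a finite product space, each of which does not depend on the
coordinates `e s'` of the others and has conditional probability at most `p` in its own
coordinate, hold simultaneously with probability at most `p ^ #S`. -/
lemma card_forall_le {ι σ V : Type*} [Fintype ι] [DecidableEq ι] [Fintype V] [Nonempty V]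
    (e : σ → ι) (Bad : σ → (ι → V) → Prop) {p : ℝ} (hp0 : 0 ≤ p) (S : Finset σ)
    (hind : ∀ s ∈ S, ∀ s' ∈ S, s ≠ s' → ∀ ω v, Bad s (Function.update ω (e s') v) ↔ Bad s ω)
    (hp : ∀ s ∈ S, ∀ ω : ι → V,
      ((Finset.univ.filter fun v => Bad s (Function.update ω (e s) v)).card : ℝ)
        ≤ p * Fintype.card V) :
    ((Finset.univ.filter fun ω : ι → V => ∀ s ∈ S, Bad s ω).card : ℝ)
      ≤ p ^ S.card * Fintype.card (ι → V) := by
  induction S using Finset.induction_on with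
  | empty => simp
  | insert s S hs ih =>
    have ih' := ih (fun t ht t' ht' => hind t (Finset.mem_insert_of_mem ht) t'
      (Finset.mem_insert_of_mem ht')) (fun t ht => hp t (Finset.mem_insert_of_mem ht))
    have hV : (0 : ℝ) < Fintype.card V := by exact_mod_cast Fintype.card_pos
    set F := Finset.univ.filter fun ω : ι → V => ∀ t ∈ S, Bad t ω with hF
    set G := Finset.univ.filter fun ω : ι → V => ∀ t ∈ insert s S, Bad t ω with hG
    have hswap : ∀ g : (ι → V) → ℝ, ∑ ω, ∑ v, g (Function.update ω (e s) v)
        = Fintype.card V * ∑ ω, g ω := by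
      intro g
      rw [← Fintype.sum_prod_type' (f := fun ω v => g (Function.update ω (e s) v))]
      have : ∑ x : (ι → V) × V, g (Function.update x.1 (e s) x.2)
          = ∑ x : (ι → V) × V, g x.1 := by
        refine Finset.sum_nbij' (fun x => (Function.update x.1 (e s) x.2, x.1 (e s)))
          (fun x => (Function.update x.1 (e s) x.2, x.1 (e s))) ?_ ?_ ?_ ?_ ?_ <;> simp
      rw [this, Fintype.sum_prod_type]
      simp [Finset.mul_sum]
    have hGsum : (G.card : ℝ) = ∑ ω, if ω ∈ G then (1 : ℝ) else 0 := by
      simp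
    have hFsum : (F.card : ℝ) = ∑ ω, if ω ∈ F then (1 : ℝ) else 0 := by
      simp
    have hmem : ∀ ω v, Function.update ω (e s) v ∈ G ↔
        ω ∈ F ∧ Bad s (Function.update ω (e s) v) := by
      intro ω v
      simp only [hG, hF, Finset.mem_filter, Finset.mem_univ, true_and, Finset.forall_mem_insert]
      rw [and_comm]
      refine and_congr_left fun _ => forall₂_congr fun t ht => ?_
      exact hind t (Finset.mem_insert_of_mem ht) s (Finset.mem_insert_self _ _)
        (fun h => hs (h ▸ ht)) ω v
    have hle : ∀ ω, ∑ v, (if Function.update ω (e s) v ∈ G then (1 : ℝ) else 0)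
        ≤ p * Fintype.card V * if ω ∈ F then (1 : ℝ) else 0 := by
      intro ω
      by_cases hω : ω ∈ F
      · simp only [hmem, hω, true_and, if_true, mul_one]
        simpa using hp s (Finset.mem_insert_self _ _) ω
      · simp [hmem, hω]
    have key : (Fintype.card V : ℝ) * G.card ≤ Fintype.card V * (p * F.card) := by
      rw [hGsum, ← hswap, hFsum]
      refine (Finset.sum_le_sum fun ω _ => hle ω).trans_eq ?_
      rw [← Finset.mul_sum]; ring
    rw [Finset.card_insert_of_notMem hs, pow_succ']
    calc (G.card : ℝ) ≤ p * F.card := le_of_mul_le_mul_left key hV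
      _ ≤ p * (p ^ S.card * Fintype.card (ι → V)) := by gcongr
      _ = _ := by ring

lemma card_abs_affine_le (V : ℕ) {A B τ : ℝ} (hB : 0 < B) :
    ((Finset.univ.filter fun v : Fin V => |A + B * (v : ℕ)| ≤ τ).card : ℝ)
      ≤ max (2 * τ / B + 1) 0 := by
  set lo := (-τ - A) / B with hlo
  set hi := (τ - A) / B with hhi
  have hcard : (Finset.univ.filter fun v : Fin V => |A + B * (v : ℕ)| ≤ τ).card
      ≤ (Finset.Icc ⌈lo⌉ ⌊hi⌋).card := by
    refine Finset.card_le_card_of_injOn (fun v : Fin V => ((v : ℕ) : ℤ)) ?_ ?_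
    · intro v hv
      simp only [Finset.coe_filter, Finset.mem_univ, true_and, Set.mem_ofPred_eq, abs_le] at hv
      simp only [Finset.coe_Icc, Set.mem_Icc, Int.ceil_le, Int.le_floor, Int.cast_natCast]
      rw [hlo, hhi, div_le_iff₀ hB, le_div_iff₀ hB]
      constructor <;> linarith [hv.1, hv.2]
    · intro v _ w _ h
      exact Fin.ext (Int.ofNat.inj h)
  rw [Int.card_Icc] at hcard
  have h1 : (((⌊hi⌋ + 1 - ⌈lo⌉).toNat : ℕ) : ℝ) = max ((⌊hi⌋ : ℝ) + 1 - ⌈lo⌉) 0 := by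
    have : (((⌊hi⌋ + 1 - ⌈lo⌉).toNat : ℤ) : ℝ) = ((max (⌊hi⌋ + 1 - ⌈lo⌉) 0 : ℤ) : ℝ) := by
      rw [Int.toNat_eq_max]
    push_cast at this
    simpa using this
  have h2 : hi - lo = 2 * τ / B := by rw [hhi, hlo]; ring
  calc _ ≤ (((⌊hi⌋ + 1 - ⌈lo⌉).toNat : ℕ) : ℝ) := by exact_mod_cast hcard
    _ = max ((⌊hi⌋ : ℝ) + 1 - ⌈lo⌉) 0 := h1
    _ ≤ _ := by
      refine max_le_max ?_ le_rfl
      linarith [Int.floor_le hi, Int.le_ceil lo]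

lemma block_bounds {b m : ℕ} [NeZero b] {k l : ℕ} (hk : k ≤ m) (hl : l < b ^ m) :
    l / b ^ (m - k) < b ^ k ∧
    ((l / b ^ (m - k) : ℕ) : ℝ) ≤ (b : ℝ) ^ k * (l / (b : ℝ) ^ m) ∧
    (b : ℝ) ^ k * (l / (b : ℝ) ^ m) ≤ ((l / b ^ (m - k) : ℕ) : ℝ) + 1 := by
  have hb : 0 < b := NeZero.pos b
  have hbR : (0 : ℝ) < b := by exact_mod_cast hb
  have hpow : b ^ m = b ^ k * b ^ (m - k) := by rw [← pow_add]; congr 1; omega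
  have hpowR : (b : ℝ) ^ m = b ^ k * b ^ (m - k) := by exact_mod_cast hpow
  have heq : (b : ℝ) ^ k * (l / (b : ℝ) ^ m) = l / (b : ℝ) ^ (m - k) := by
    rw [hpowR]; field_simp
  have hpos : 0 < b ^ (m - k) := by positivity
  have hposR : (0 : ℝ) < (b : ℝ) ^ (m - k) := by positivity
  refine ⟨?_, ?_, ?_⟩
  · rw [Nat.div_lt_iff_lt_mul hpos, ← hpow]; exact hl
  · rw [heq, le_div_iff₀ hposR]
    exact_mod_cast Nat.div_mul_le_self l (b ^ (m - k))
  · rw [heq, div_le_iff₀ hposR]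
    have := (Nat.lt_div_mul_add (a := l) hpos).le
    rw [add_mul, one_mul]
    exact_mod_cast this

section Template

variable {b m V : ℕ} [NeZero b] [NeZero m]

/-- The coordinate which governs the `j`-th spline coefficient of level `k`; it is `b ^ k`-periodic
in `j`. -/
def coefIndex (b m : ℕ) [NeZero b] [NeZero m] (k : ℕ) (j : ℤ) : Fin m × Fin (b ^ m) :=
  (Fin.ofNat m k, Fin.ofNat (b ^ m) (j % ((b ^ k : ℕ) : ℤ)).toNat)

/-- The `j`-th spline coefficient of level `k`, a number of `[0,1]`. -/
noncomputable def levelCoef (ω : Fin m × Fin (b ^ m) → Fin V) (k : ℕ) (j : ℤ) : ℝ :=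
  ((ω (coefIndex b m k j) : ℕ) : ℝ) / V

/-- A sum of `m` consecutive spline levels, of meshes `b ^ (-k)` and heights `(r / b) ^ k`. -/
noncomputable def template (r : ℝ) (ω : Fin m × Fin (b ^ m) → Fin V) (y : ℝ) : ℝ :=
  ∑ k ∈ Finset.range m, (r / b) ^ k * spline (b ^ k) (levelCoef ω k) (b ^ k * y)

lemma levelCoef_mem (ω : Fin m × Fin (b ^ m) → Fin V) (k : ℕ) (j : ℤ) :
    levelCoef ω k j ∈ Icc (0 : ℝ) 1 := by
  unfold levelCoef
  refine ⟨by positivity, div_le_one_of_le₀ ?_ (by positivity)⟩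
  exact_mod_cast (ω (coefIndex b m k j)).2.le

lemma coefIndex_eq_of_modEq {k : ℕ} {i j : ℤ} (h : i % ((b ^ k : ℕ) : ℤ) = j % ((b ^ k : ℕ) : ℤ)) :
    coefIndex b m k i = coefIndex b m k j := by
  unfold coefIndex; rw [h]

lemma modEq_of_coefIndex_eq {k k' : ℕ} (hk : k < m) (hk' : k' < m) {i j : ℤ}
    (h : coefIndex b m k i = coefIndex b m k' j) :
    k = k' ∧ i % ((b ^ k : ℕ) : ℤ) = j % ((b ^ k : ℕ) : ℤ) := by
  have hb : 0 < b := NeZero.pos b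
  unfold coefIndex at h
  rw [Prod.mk.injEq, Fin.ext_iff, Fin.ext_iff] at h
  simp only [Fin.val_ofNat] at h
  rw [Nat.mod_eq_of_lt hk, Nat.mod_eq_of_lt hk'] at h
  obtain ⟨rfl, h⟩ := h
  refine ⟨rfl, ?_⟩
  have hpos : (0 : ℤ) < ((b ^ k : ℕ) : ℤ) := by positivity
  have hle : b ^ k ≤ b ^ m := Nat.pow_le_pow_right hb hk.le
  have aux : ∀ x : ℤ, (x % ((b ^ k : ℕ) : ℤ)).toNat < b ^ m := by
    intro x
    have h1 := Int.emod_lt_of_pos x hpos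
    have h2 := Int.emod_nonneg x hpos.ne'
    omega
  rw [Nat.mod_eq_of_lt (aux i), Nat.mod_eq_of_lt (aux j)] at h
  have h1 := Int.emod_nonneg i hpos.ne'
  have h2 := Int.emod_nonneg j hpos.ne'
  omega

lemma template_update_eq (r : ℝ) (ω : Fin m × Fin (b ^ m) → Fin V) {κ : ℕ} (hκ : κ < m)
    (j : ℤ) (v : Fin V) (y : ℝ) :
    template r (Function.update ω (coefIndex b m κ j) v) y =
      (∑ k ∈ (Finset.range m).erase κ, (r / b) ^ k * spline (b ^ k) (levelCoef ω k) (b ^ k * y))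
      + (r / b) ^ κ * spline (b ^ κ)
        (levelCoef (Function.update ω (coefIndex b m κ j) v) κ) (b ^ κ * y) := by
  unfold template
  rw [← Finset.sum_erase_add _ _ (Finset.mem_range.2 hκ)]
  congr 1
  refine Finset.sum_congr rfl fun k hk => ?_
  rw [Finset.mem_erase, Finset.mem_range] at hk
  congr 2
  funext i
  unfold levelCoef
  rw [Function.update_of_ne]
  intro h
  exact hk.1 (modEq_of_coefIndex_eq hk.2 hκ h).1

lemma template_update_of_ne (hb : Even b) (r : ℝ) (ω : Fin m × Fin (b ^ m) → Fin V) {κ l j : ℕ}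
    (hκ0 : 1 ≤ κ) (hκ : κ < m) (hl : l < b ^ m) (hj : j < b ^ κ)
    (hne : l / b ^ (m - κ) ≠ j) (hpar : l / b ^ (m - κ) % 2 = j % 2) (v : Fin V) :
    template r (Function.update ω (coefIndex b m κ j) v) (l / (b : ℝ) ^ m)
      = template r ω (l / (b : ℝ) ^ m) := by
  obtain ⟨h1, h2, h3⟩ := block_bounds (b := b) hκ.le hl
  set a := l / b ^ (m - κ)
  clear_value a
  have e1 : template r ω (l / (b : ℝ) ^ m)
      = template r (Function.update ω (coefIndex b m κ j) (ω (coefIndex b m κ j)))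
        (l / (b : ℝ) ^ m) := by rw [Function.update_eq_self]
  rw [e1, template_update_eq r ω hκ, template_update_eq r ω hκ]
  congr 2
  have hdvd : (2 : ℤ) ∣ ((b ^ κ : ℕ) : ℤ) := by
    have : 2 ∣ b ^ κ := dvd_pow hb.two_dvd (by omega)
    exact_mod_cast this
  have hcoef : ∀ i : ℤ, a - 1 ≤ i → i ≤ a + 1 → ∀ u : Fin V,
      levelCoef (Function.update ω (coefIndex b m κ j) u) κ i = levelCoef ω κ i := by
    intro i hi1 hi2 u
    unfold levelCoef
    rw [Function.update_of_ne]
    intro h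
    have hmod := (modEq_of_coefIndex_eq hκ hκ h).2
    have hd : ((b ^ κ : ℕ) : ℤ) ∣ i - j := (Int.emod_emod_of_dvd _ dvd_rfl ▸
      (Int.emod_eq_emod_iff_emod_sub_eq_zero.1 hmod) |> Int.dvd_of_emod_eq_zero)
    have h2d := hdvd.trans hd
    have hia : i = a := by omega
    subst hia
    obtain ⟨t, ht⟩ := hd
    have ht0 : t = 0 := by
      have hp : (0 : ℤ) < ((b ^ κ : ℕ) : ℤ) := by omega
      have : |((b ^ κ : ℕ) : ℤ) * t| < ((b ^ κ : ℕ) : ℤ) := by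
        rw [← ht, abs_lt]; omega
      rw [abs_mul, abs_of_pos hp] at this
      have : |t| < 1 := by nlinarith
      exact Int.abs_lt_one_iff.1 this
    rw [ht0] at ht
    omega
  have hsp := fun c : ℤ → ℝ => spline_eq_three (K := b ^ κ) (c := c) (a := (a : ℤ))
    (y := (b : ℝ) ^ κ * (l / (b : ℝ) ^ m)) (by positivity) (by exact_mod_cast h1)
    (by exact_mod_cast h2) (by exact_mod_cast h3)
  rw [hsp, hsp]
  simp only [hcoef (a - 1) (by omega) (by omega), hcoef a (by omega) (by omega),
    hcoef (a + 1) (by omega) (by omega)]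

lemma exists_template_update (hb : 3 ≤ b) (r : ℝ) (ω : Fin m × Fin (b ^ m) → Fin V) {κ l : ℕ}
    (hκ0 : 1 ≤ κ) (hκ : κ < m) (hl : l < b ^ m) :
    ∃ A β : ℝ, 1 / 2 ≤ β ∧ ∀ v : Fin V,
      template r (Function.update ω (coefIndex b m κ (l / b ^ (m - κ) : ℕ)) v) (l / (b : ℝ) ^ m)
        = A + (r / b) ^ κ * β / V * (v : ℕ) := by
  obtain ⟨h1, h2, h3⟩ := block_bounds (b := b) hκ.le hl
  set a := l / b ^ (m - κ) with ha
  set x := (b : ℝ) ^ κ * (l / (b : ℝ) ^ m) with hx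
  have hbig : 3 ≤ b ^ κ := hb.trans (Nat.le_self_pow (by omega) b)
  have hcoef : ∀ i : ℤ, (i = a - 1 ∨ i = a + 1) → ∀ u : Fin V,
      levelCoef (Function.update ω (coefIndex b m κ a) u) κ i = levelCoef ω κ i := by
    intro i hi u
    unfold levelCoef
    rw [Function.update_of_ne]
    intro h
    have hmod := (modEq_of_coefIndex_eq hκ hκ h).2
    have hd : ((b ^ κ : ℕ) : ℤ) ∣ i - a :=
      Int.dvd_of_emod_eq_zero (Int.emod_eq_emod_iff_emod_sub_eq_zero.1 hmod)
    have hle := Int.le_of_dvd (b := |i - a|) (by rcases hi with h | h <;> simp [h])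
      ((dvd_abs _ _).2 hd)
    have : |i - a| = 1 := by rcases hi with h | h <;> simp [h]
    omega
  have hsp := fun c : ℤ → ℝ => spline_eq_three (K := b ^ κ) (c := c) (a := (a : ℤ))
    (y := x) (by positivity) (by exact_mod_cast h1) (by exact_mod_cast h2) (by exact_mod_cast h3)
  refine ⟨(∑ k ∈ (Finset.range m).erase κ,
      (r / b) ^ k * spline (b ^ k) (levelCoef ω k) (b ^ k * (l / (b : ℝ) ^ m)))
      + (r / b) ^ κ * (levelCoef ω κ (a - 1) * bspl (x - a + 1)
        + levelCoef ω κ (a + 1) * bspl (x - a - 1)), bspl (x - a),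
    half_le_bspl (by linarith) (by linarith), fun v => ?_⟩
  rw [template_update_eq r ω hκ, ← hx, hsp, hcoef _ (Or.inl rfl), hcoef _ (Or.inr rfl)]
  have : levelCoef (Function.update ω (coefIndex b m κ a) v) κ a = ((v : ℕ) : ℝ) / V := by
    unfold levelCoef; rw [Function.update_self]
  rw [this]
  push_cast
  ring

end Template

section TemplateContact

variable {b m V : ℕ} [NeZero b] [NeZero m]

/-- The block `[a b^(-κ), (a+1) b^(-κ))` contains a point of the grid `b^(-m) ℤ` at which the
template is `τ`-close to `P`. -/
def BlockContact (r τ : ℝ) (P : ℝ → ℝ) (ω : Fin m × Fin (b ^ m) → Fin V) (κ a : ℕ) : Prop :=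
  ∃ l < b ^ m, l / b ^ (m - κ) = a ∧ |template r ω (l / (b : ℝ) ^ m) - P (l / (b : ℝ) ^ m)| ≤ τ

lemma blockContact_update_iff (hb : Even b) (r τ : ℝ) (P : ℝ → ℝ)
    (ω : Fin m × Fin (b ^ m) → Fin V) {κ a j : ℕ} (hκ0 : 1 ≤ κ) (hκ : κ < m) (hj : j < b ^ κ)
    (hne : a ≠ j) (hpar : a % 2 = j % 2) (v : Fin V) :
    BlockContact r τ P (Function.update ω (coefIndex b m κ j) v) κ a ↔
      BlockContact r τ P ω κ a := by
  unfold BlockContact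
  refine exists_congr fun l => and_congr_right fun hl => and_congr_right fun hla => ?_
  subst hla
  rw [template_update_of_ne hb r ω hκ0 hκ hl hj hne hpar]

open scoped Classical in
lemma card_blockContact_update_le (hb : 3 ≤ b) {r : ℝ} (hr : 0 < r) {C : ℕ}
    (P : ℝ → ℝ) (hV : 1 ≤ V * (r / b) ^ m) (hrb : r ≤ b)
    (ω : Fin m × Fin (b ^ m) → Fin V) {κ a : ℕ} (hκ0 : 1 ≤ κ) (hκ : κ < m) :
    ((Finset.univ.filter fun v : Fin V => BlockContact r (C * (r / b) ^ m) P
      (Function.update ω (coefIndex b m κ a) v) κ a).card : ℝ)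
      ≤ (4 * C + 1) * r ^ (m - κ) * V := by
  have hb0 : 0 < b := by omega
  have hbR : (0 : ℝ) < b := by exact_mod_cast hb0
  have hVpos : (0 : ℝ) < V := by
    rcases Nat.eq_zero_or_pos V with h | h
    · simp [h] at hV; linarith
    · exact_mod_cast h
  set L := (Finset.range (b ^ m)).filter fun l => l / b ^ (m - κ) = a with hL
  set X : ℕ → Finset (Fin V) := fun l => Finset.univ.filter fun v : Fin V =>
    |template r (Function.update ω (coefIndex b m κ a) v) (l / (b : ℝ) ^ m)
      - P (l / (b : ℝ) ^ m)| ≤ C * (r / b) ^ m with hX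
  have hsub : (Finset.univ.filter fun v : Fin V => BlockContact r (C * (r / b) ^ m) P
      (Function.update ω (coefIndex b m κ a) v) κ a) ⊆ L.biUnion X := by
    intro v hv
    obtain ⟨l, hl, hla, h⟩ := (Finset.mem_filter.1 hv).2
    rw [Finset.mem_biUnion]
    exact ⟨l, by simp [hL, hl, hla], by simp [hX, h]⟩
  have hLcard : L.card ≤ b ^ (m - κ) := by
    have : L ⊆ Finset.Ico (a * b ^ (m - κ)) ((a + 1) * b ^ (m - κ)) := by
      intro l hl
      simp only [hL, Finset.mem_filter] at hl
      rw [Finset.mem_Ico, ← hl.2]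
      refine ⟨Nat.div_mul_le_self _ _, ?_⟩
      rw [add_mul, one_mul]
      exact Nat.lt_div_mul_add (by positivity)
    refine (Finset.card_le_card this).trans ?_
    rw [Nat.card_Ico, add_mul, one_mul, Nat.add_sub_cancel_left]
  have hw : (r / b) ^ m = (r / b) ^ κ * (r / b) ^ (m - κ) := by
    rw [← pow_add]; congr 1; omega
  have hq0 : 0 < r / b := by positivity
  have hq1 : r / b ≤ 1 := div_le_one_of_le₀ hrb hbR.le
  have hXcard : ∀ l ∈ L, ((X l).card : ℝ) ≤ (4 * C + 1) * (r / b) ^ (m - κ) * V := by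
    intro l hl
    simp only [hL, Finset.mem_filter, Finset.mem_range] at hl
    obtain ⟨A, β, hβ, hA⟩ := exists_template_update hb r ω hκ0 hκ hl.1
    rw [hl.2] at hA
    have hB : 0 < (r / b) ^ κ * β / V := by positivity
    have := card_abs_affine_le V (A := A - P (l / (b : ℝ) ^ m)) (τ := C * (r / b) ^ m) hB
    simp only [hX, hA]
    refine (le_trans (le_of_eq ?_) this).trans ?_
    · congr 2; ext v; simp only [Finset.mem_filter]; rw [add_sub_right_comm]
    · refine max_le ?_ (by positivity)
      have h1 : 2 * (C * (r / b) ^ m) / ((r / b) ^ κ * β / V)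
          = (2 / β) * C * (r / b) ^ (m - κ) * V := by
        rw [hw]
        have : (r / b) ^ κ ≠ 0 := by positivity
        field_simp
      have h2 : 2 / β ≤ 4 := by rw [div_le_iff₀ (by linarith)]; linarith
      have h3 : 1 ≤ (r / b) ^ (m - κ) * V := by
        refine hV.trans ?_
        rw [mul_comm]
        gcongr ?_ * _
        exact pow_le_pow_of_le_one hq0.le hq1 (by omega)
      have h4 : (2 / β) * C * (r / b) ^ (m - κ) * V ≤ 4 * C * (r / b) ^ (m - κ) * V := by
        gcongr
      rw [h1]
      linarith
  calc _ ≤ ((L.biUnion X).card : ℝ) := by exact_mod_cast Finset.card_le_card hsub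
    _ ≤ ∑ l ∈ L, ((X l).card : ℝ) := by exact_mod_cast Finset.card_biUnion_le
    _ ≤ L.card * ((4 * C + 1) * (r / b) ^ (m - κ) * V) := by
        simpa using Finset.sum_le_card_nsmul _ _ _ hXcard
    _ ≤ (b ^ (m - κ) : ℝ) * ((4 * C + 1) * (r / b) ^ (m - κ) * V) := by
        gcongr; exact_mod_cast hLcard
    _ = _ := by rw [div_pow]; field_simp

open scoped Classical in
lemma card_forall_blockContact_le (hb : 3 ≤ b) (hbe : Even b) {r : ℝ} (hr : 0 < r) (hr1 : r ≤ 1)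
    {C j₀ : ℕ} (P : ℝ → ℝ) (hV : 1 ≤ V * (r / b) ^ m) {κ i : ℕ} (h1 : 1 ≤ κ)
    (h2 : κ + j₀ ≤ m) (hκ : κ < m) (hi : i < b ^ (κ - 1)) {S : Finset ℕ} (hS : ∀ c ∈ S, c < b)
    (hpar : ∀ c ∈ S, ∀ c' ∈ S, c % 2 = c' % 2) :
    ((Finset.univ.filter fun ω : Fin m × Fin (b ^ m) → Fin V =>
      ∀ c ∈ S, BlockContact r (C * (r / b) ^ m) P ω κ (i * b + c)).card : ℝ)
      ≤ ((4 * C + 1) * r ^ j₀) ^ S.card * Fintype.card (Fin m × Fin (b ^ m) → Fin V) := by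
  have hb0 : 0 < b := by omega
  have hbR : (1 : ℝ) ≤ b := by exact_mod_cast hb0
  have hVpos : 0 < V := by
    rcases Nat.eq_zero_or_pos V with h | h
    · simp [h] at hV; linarith
    · exact h
  have : Nonempty (Fin V) := ⟨⟨0, hVpos⟩⟩
  have hlt : ∀ c ∈ S, i * b + c < b ^ κ := by
    intro c hc
    have hcb := hS c hc
    have : b ^ κ = b ^ (κ - 1) * b := by rw [← pow_succ]; congr 1; omega
    rw [this]
    nlinarith
  refine card_forall_le (ι := Fin m × Fin (b ^ m)) (V := Fin V)
    (fun c : ℕ => coefIndex b m κ ((i * b + c : ℕ) : ℤ))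
    (fun c ω => BlockContact r (C * (r / b) ^ m) P ω κ (i * b + c))
    (p := (4 * C + 1) * r ^ j₀) (by positivity) S ?_ ?_
  · intro c hc c' hc' hne ω v
    have hne' : i * b + c ≠ i * b + c' := by omega
    have hpar' : (i * b + c) % 2 = (i * b + c') % 2 := by
      rw [Nat.add_mod, hpar c hc c' hc', ← Nat.add_mod]
    exact blockContact_update_iff hbe r _ _ ω h1 hκ (hlt c' hc') hne' hpar' v
  · intro c hc ω
    refine (card_blockContact_update_le hb hr P hV (hr1.trans hbR) ω h1 hκ).trans ?_
    rw [Fintype.card_fin]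
    gcongr ?_ * _
    gcongr _ * ?_
    exact pow_le_pow_of_le_one hr.le hr1 (by omega)

/-- The quadratic polynomial with coefficients `a₀, a₁, a₂` in units of `b ^ (-2m)`. -/
noncomputable def netQuadratic (b m : ℕ) (a : ℤ × ℤ × ℤ) (y : ℝ) : ℝ :=
  (a.1 + a.2.1 * y + a.2.2 * y ^ 2) / (b : ℝ) ^ (2 * m)

/-- There is a choice of coefficients such that no quadratic polynomial of the net makes contact
in `q` children of equal parity of a block. -/
lemma exists_coef_few_children (hb : 3 ≤ b) (hbe : Even b) {r : ℝ} (hr : 0 < r) (hr1 : r ≤ 1)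
    {C j₀ q Z : ℕ} (hj₀ : 1 ≤ j₀) (hV : 1 ≤ V * (r / b) ^ m)
    (hunion : (m * b ^ m * (2 * Z + 1) ^ 3 * (b * ((4 * C + 1) * r ^ j₀)) ^ q : ℝ) < 1) :
    ∃ ω : Fin m × Fin (b ^ m) → Fin V, ∀ κ, 1 ≤ κ → κ + j₀ ≤ m → ∀ i < b ^ (κ - 1),
      ∀ a ∈ Finset.Icc (-Z : ℤ) Z ×ˢ Finset.Icc (-Z : ℤ) Z ×ˢ Finset.Icc (-Z : ℤ) Z,
      ∀ S ∈ (Finset.range b).powersetCard q, (∀ c ∈ S, ∀ c' ∈ S, c % 2 = c' % 2) →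
      ¬ ∀ c ∈ S, BlockContact r (C * (r / b) ^ m) (netQuadratic b m a) ω κ (i * b + c) := by
  classical
  have hb0 : 0 < b := by omega
  have hbR : (1 : ℝ) ≤ b := by exact_mod_cast hb0
  have hVpos : 0 < V := by
    rcases Nat.eq_zero_or_pos V with h | h
    · simp [h] at hV; linarith
    · exact h
  set Ω := Fin m × Fin (b ^ m) → Fin V
  have hΩne : Nonempty Ω := ⟨fun _ => ⟨0, hVpos⟩⟩
  set p : ℝ := (4 * C + 1) * r ^ j₀ with hp
  have hp0 : 0 ≤ p := by positivity
  set net := Finset.Icc (-Z : ℤ) Z ×ˢ Finset.Icc (-Z : ℤ) Z ×ˢ Finset.Icc (-Z : ℤ) Z with hnet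
  set E := ((Finset.range m ×ˢ Finset.range (b ^ m)) ×ˢ net ×ˢ (Finset.range b).powersetCard q)
    with hE
  set ev : (ℕ × ℕ) × (ℤ × ℤ × ℤ) × Finset ℕ → Finset Ω := fun x =>
    Finset.univ.filter fun ω => (1 ≤ x.1.1 ∧ x.1.1 + j₀ ≤ m ∧ x.1.2 < b ^ (x.1.1 - 1) ∧
      ∀ c ∈ x.2.2, ∀ c' ∈ x.2.2, c % 2 = c' % 2) ∧ ∀ c ∈ x.2.2,
      BlockContact r (C * (r / b) ^ m) (netQuadratic b m x.2.1) ω x.1.1 (x.1.2 * b + c) with hev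
  have hevcard : ∀ x ∈ E, ((ev x).card : ℝ) ≤ p ^ q * Fintype.card Ω := by
    rintro ⟨⟨κ, i⟩, a, S⟩ hx
    simp only [hE, Finset.mem_product, Finset.mem_powersetCard] at hx
    obtain ⟨-, -, hSb, hSq⟩ := hx
    by_cases hval : 1 ≤ κ ∧ κ + j₀ ≤ m ∧ i < b ^ (κ - 1) ∧ ∀ c ∈ S, ∀ c' ∈ S, c % 2 = c' % 2
    swap
    · have : ev ((κ, i), a, S) = ∅ := by
        simp only [hev]
        exact Finset.filter_eq_empty_iff.2 fun ω _ h => hval h.1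
      rw [this]; simp only [Finset.card_empty, Nat.cast_zero]; positivity
    obtain ⟨h1, h2, hi, hpar⟩ := hval
    have key := card_forall_blockContact_le hb hbe hr hr1 (C := C) (netQuadratic b m a) hV h1 h2 (by omega) hi
      (fun c hc => Finset.mem_range.1 (hSb hc)) hpar
    rw [hSq] at key
    refine le_trans ?_ key
    exact_mod_cast Finset.card_le_card fun ω hω => by
      simp only [hev, Finset.mem_filter, Finset.mem_univ, true_and] at hω
      simpa using hω.2
  have hEcard : (E.card : ℝ) ≤ m * b ^ m * (2 * Z + 1) ^ 3 * b ^ q := by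
    have hZ : (Finset.Icc (-Z : ℤ) Z).card = 2 * Z + 1 := by rw [Int.card_Icc]; omega
    have : E.card = m * b ^ m * ((2 * Z + 1) * ((2 * Z + 1) * (2 * Z + 1)) * b.choose q) := by
      simp only [hE, hnet, Finset.card_product, hZ, Finset.card_range, Finset.card_powersetCard]
    have h2 : E.card ≤ m * b ^ m * (2 * Z + 1) ^ 3 * b ^ q := by
      rw [this]
      calc _ ≤ m * b ^ m * ((2 * Z + 1) * ((2 * Z + 1) * (2 * Z + 1)) * b ^ q) := by
            gcongr; exact Nat.choose_le_pow _ _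
        _ = _ := by ring
    exact_mod_cast h2
  have hΩ : (0 : ℝ) < Fintype.card Ω := by exact_mod_cast Fintype.card_pos
  have hlt : (E.biUnion ev).card < (Finset.univ : Finset Ω).card := by
    have : ((E.biUnion ev).card : ℝ) < Fintype.card Ω := by
      calc ((E.biUnion ev).card : ℝ) ≤ ∑ x ∈ E, ((ev x).card : ℝ) := by
            exact_mod_cast Finset.card_biUnion_le
        _ ≤ E.card * (p ^ q * Fintype.card Ω) := by
            simpa using Finset.sum_le_card_nsmul _ _ _ hevcard
        _ ≤ (m * b ^ m * (2 * Z + 1) ^ 3 * b ^ q) * (p ^ q * Fintype.card Ω) := by gcongr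
        _ = (m * b ^ m * (2 * Z + 1) ^ 3 * (b * p) ^ q) * Fintype.card Ω := by
            rw [mul_pow (b : ℝ) p q]; ring
        _ < 1 * Fintype.card Ω := by gcongr
        _ = _ := one_mul _
    rw [Finset.card_univ]; exact_mod_cast this
  obtain ⟨ω, -, hω⟩ := Finset.exists_mem_notMem_of_card_lt_card hlt
  refine ⟨ω, fun κ h1 h2 i hi a ha S hS hpar hall => hω ?_⟩
  rw [Finset.mem_biUnion]
  refine ⟨((κ, i), a, S), ?_, ?_⟩
  · simp only [hE, Finset.mem_product, Finset.mem_range]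
    refine ⟨⟨by omega, hi.trans_le (Nat.pow_le_pow_right hb0 (by omega))⟩, ha, hS⟩
  · simp only [hev, Finset.mem_filter, Finset.mem_univ, true_and]
    exact ⟨⟨h1, h2, hi, hpar⟩, hall⟩

end TemplateContact

lemma geom_sum_le_two {x : ℝ} (h0 : 0 ≤ x) (h1 : x ≤ 1 / 2) (n : ℕ) :
    ∑ k ∈ Finset.range n, x ^ k ≤ 2 := by
  have : ∑ k ∈ Finset.range n, x ^ k ≤ 2 - 2 * x ^ n := by
    induction n with
    | zero => simp
    | succ n ih =>
      rw [Finset.sum_range_succ, pow_succ]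
      nlinarith [pow_nonneg h0 n]
  linarith [pow_nonneg h0 n]

lemma abs_netQuadratic_round_sub_le {b m : ℕ} [NeZero b] (p₀ p₁ p₂ : ℝ) {y : ℝ} (h0 : 0 ≤ y) (h1 : y ≤ 1) :
    |netQuadratic b m (round (p₀ * (b : ℝ) ^ (2 * m)), round (p₁ * (b : ℝ) ^ (2 * m)),
      round (p₂ * (b : ℝ) ^ (2 * m))) y - (p₀ + p₁ * y + p₂ * y ^ 2)| ≤ 3 / (b : ℝ) ^ (2 * m) := by
  have hbR : (0 : ℝ) < b := by exact_mod_cast NeZero.pos b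
  have hB : (0 : ℝ) < (b : ℝ) ^ (2 * m) := by positivity
  set B := (b : ℝ) ^ (2 * m) with hBdef
  have e : netQuadratic b m (round (p₀ * B), round (p₁ * B), round (p₂ * B)) y
      - (p₀ + p₁ * y + p₂ * y ^ 2) = ((round (p₀ * B) - p₀ * B) + (round (p₁ * B) - p₁ * B) * y
        + (round (p₂ * B) - p₂ * B) * y ^ 2) / B := by
    unfold netQuadratic
    rw [← hBdef]
    field_simp
    ring
  rw [e, abs_div, abs_of_pos hB]
  gcongr
  have a0 := abs_sub_round (p₀ * B)
  have a1 := abs_sub_round (p₁ * B)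
  have a2 := abs_sub_round (p₂ * B)
  rw [abs_sub_comm] at a0 a1 a2
  have hy2 : y ^ 2 ≤ 1 := pow_le_one₀ h0 h1
  calc _ ≤ |(round (p₀ * B) - p₀ * B : ℝ)| + |(round (p₁ * B) - p₁ * B) * y|
        + |(round (p₂ * B) - p₂ * B) * y ^ 2| := abs_add_three _ _ _
    _ = |(round (p₀ * B) - p₀ * B : ℝ)| + |(round (p₁ * B) - p₁ * B : ℝ)| * y
        + |(round (p₂ * B) - p₂ * B : ℝ)| * y ^ 2 := by
        rw [abs_mul, abs_mul, abs_of_nonneg h0, abs_of_nonneg (by positivity : 0 ≤ y ^ 2)]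
    _ ≤ 1 / 2 + 1 / 2 * 1 + 1 / 2 * 1 := by gcongr
    _ ≤ 3 := by norm_num

lemma round_mem_Icc {p D : ℝ} {K Z : ℕ} (hp : |p| ≤ D) (hZ : D * K + 1 ≤ Z) :
    round (p * K) ∈ Finset.Icc (-Z : ℤ) Z := by
  have h := abs_le.1 (abs_sub_round (p * K))
  have hpK : |p * K| ≤ D * K := by
    rw [abs_mul, Nat.abs_cast]; gcongr
  have h2 := abs_le.1 hpK
  rw [Finset.mem_Icc]
  have h3 : (-(Z : ℝ)) ≤ round (p * K) := by linarith [h.2, h2.1]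
  have h4 : (round (p * K) : ℝ) ≤ Z := by linarith [h.1, h2.2]
  exact ⟨by exact_mod_cast h3, by exact_mod_cast h4⟩

section TemplateCount

variable {b m V : ℕ} [NeZero b] [NeZero m]

lemma abs_template_le {r : ℝ} (hr : 0 ≤ r) (hrb : r / b ≤ 1 / 2)
    (ω : Fin m × Fin (b ^ m) → Fin V) (y : ℝ) : |template r ω y| ≤ 6 := by
  have h0 : 0 ≤ r / b := by positivity
  unfold template
  calc _ ≤ ∑ k ∈ Finset.range m, |(r / b) ^ k * spline (b ^ k) (levelCoef ω k) (b ^ k * y)| :=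
        Finset.abs_sum_le_sum_abs _ _
    _ ≤ ∑ k ∈ Finset.range m, (r / b) ^ k * 3 := by
        refine Finset.sum_le_sum fun k _ => ?_
        rw [abs_mul, abs_of_nonneg (pow_nonneg h0 k)]
        gcongr
        refine abs_spline_le (fun j => ?_) _ _
        rw [abs_of_nonneg (levelCoef_mem ω k j).1]
        exact (levelCoef_mem ω k j).2
    _ = (∑ k ∈ Finset.range m, (r / b) ^ k) * 3 := by rw [Finset.sum_mul]
    _ ≤ 6 := by linarith [geom_sum_le_two h0 hrb m]

open scoped Classical in
lemma card_contact_le {r τ : ℝ} {P : ℝ → ℝ} {ω : Fin m × Fin (b ^ m) → Fin V} {j₀ q : ℕ}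
    (hj₀ : j₀ ≤ m) (hq : 1 ≤ q)
    (h : ∀ κ, 1 ≤ κ → κ + j₀ ≤ m → ∀ i < b ^ (κ - 1), ∀ S ∈ (Finset.range b).powersetCard q,
      (∀ c ∈ S, ∀ c' ∈ S, c % 2 = c' % 2) → ¬ ∀ c ∈ S, BlockContact r τ P ω κ (i * b + c)) :
    ((Finset.range (b ^ m)).filter fun l : ℕ =>
      |template r ω (l / (b : ℝ) ^ m) - P (l / (b : ℝ) ^ m)| ≤ τ).card ≤ (2 * q) ^ m * b ^ j₀ := by
  have hb0 : 0 < b := NeZero.pos b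
  set A : ℕ → Finset ℕ := fun κ => (Finset.range (b ^ κ)).filter fun a => BlockContact r τ P ω κ a
    with hA
  have hstep : ∀ κ, κ + 1 + j₀ ≤ m → (A (κ + 1)).card ≤ 2 * q * (A κ).card := by
    intro κ hκ
    refine Finset.card_le_mul_card_image_of_maps_to (f := fun a => a / b) ?_ _ ?_
    · intro a ha
      simp only [hA, Finset.mem_filter, Finset.mem_range] at ha ⊢
      obtain ⟨ha1, l, hl, hla, hc⟩ := ha
      refine ⟨by rwa [Nat.div_lt_iff_lt_mul hb0, ← pow_succ], l, hl, ?_, hc⟩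
      rw [← hla, Nat.div_div_eq_div_mul, ← pow_succ]
      congr 2; omega
    · intro i hi
      simp only [hA, Finset.mem_filter, Finset.mem_range] at hi
      set T : ℕ → Finset ℕ := fun e => (Finset.range b).filter fun c => c % 2 = e ∧
        BlockContact r τ P ω (κ + 1) (i * b + c) with hT
      have hTcard : ∀ e, (T e).card ≤ q := by
        intro e
        by_contra! hlt
        obtain ⟨S, hS, hSq⟩ := Finset.exists_subset_card_eq hlt.le
        have hS' : ∀ c ∈ S, c < b ∧ c % 2 = e ∧ BlockContact r τ P ω (κ + 1) (i * b + c) := by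
          intro c hc
          simpa [hT] using hS hc
        refine h (κ + 1) (by omega) hκ i hi.1 S ?_ ?_ fun c hc => (hS' c hc).2.2
        · rw [Finset.mem_powersetCard]
          exact ⟨fun c hc => Finset.mem_range.2 (hS' c hc).1, hSq⟩
        · intro c hc c' hc'
          rw [(hS' c hc).2.1, (hS' c' hc').2.1]
      have hsub : ((A (κ + 1)).filter fun a => a / b = i)
          ⊆ (T 0 ∪ T 1).image fun c => i * b + c := by
        intro a ha
        simp only [hA, Finset.mem_filter, Finset.mem_range] at ha
        have hdiv : i * b + a % b = a := by rw [← ha.2, mul_comm]; exact Nat.div_add_mod a b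
        rw [Finset.mem_image]
        refine ⟨a % b, ?_, hdiv⟩
        simp only [hT, Finset.mem_union, Finset.mem_filter, Finset.mem_range, hdiv]
        have := Nat.mod_lt a hb0
        rcases Nat.mod_two_eq_zero_or_one (a % b) with h0 | h1
        · exact Or.inl ⟨this, h0, ha.1.2⟩
        · exact Or.inr ⟨this, h1, ha.1.2⟩
      calc _ ≤ _ := Finset.card_le_card hsub
        _ ≤ _ := Finset.card_image_le
        _ ≤ _ := Finset.card_union_le _ _
        _ ≤ _ := by linarith [hTcard 0, hTcard 1]
  have hAcard : ∀ κ, κ + j₀ ≤ m → (A κ).card ≤ (2 * q) ^ κ := by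
    intro κ
    induction κ with
    | zero =>
      intro _
      refine (Finset.card_filter_le _ _).trans ?_
      simp
    | succ κ ih =>
      intro hκ
      calc _ ≤ 2 * q * (A κ).card := hstep κ hκ
        _ ≤ 2 * q * (2 * q) ^ κ := by gcongr; exact ih (by omega)
        _ = _ := by rw [pow_succ']
  have hlast := hAcard (m - j₀) (by omega)
  calc _ ≤ b ^ j₀ * (A (m - j₀)).card := by
        refine Finset.card_le_mul_card_image_of_maps_to (f := fun l => l / b ^ j₀) ?_ _ ?_
        · intro l hl
          simp only [hA, Finset.mem_filter, Finset.mem_range] at hl ⊢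
          refine ⟨?_, l, hl.1, ?_, hl.2⟩
          · rw [Nat.div_lt_iff_lt_mul (by positivity), ← pow_add]
            convert hl.1 using 2; omega
          · congr 2; omega
        · intro i _
          have : ((Finset.range (b ^ m)).filter fun l : ℕ =>
              |template r ω (l / (b : ℝ) ^ m) - P (l / (b : ℝ) ^ m)| ≤ τ).filter
              (fun l => l / b ^ j₀ = i) ⊆ Finset.Ico (i * b ^ j₀) ((i + 1) * b ^ j₀) := by
            intro l hl
            have hl' := (Finset.mem_filter.1 hl).2
            rw [Finset.mem_Ico, ← hl']
            refine ⟨Nat.div_mul_le_self _ _, ?_⟩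
            rw [add_mul, one_mul]
            exact Nat.lt_div_mul_add (by positivity)
          refine (Finset.card_le_card this).trans ?_
          rw [Nat.card_Ico, add_mul, one_mul, Nat.add_sub_cancel_left]
    _ ≤ b ^ j₀ * (2 * q) ^ (m - j₀) := by gcongr
    _ ≤ b ^ j₀ * (2 * q) ^ m := by gcongr <;> omega
    _ = _ := mul_comm _ _

/-- For suitable coefficients, the template makes contact with any quadratic polynomial in few of
the points of the grid `b^(-m) ℤ`. -/
theorem exists_template_few_contacts (hbe : Even b) {r : ℝ} (hr : 0 < r) (hr1 : r ≤ 1 / 2)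
    (hrb : 1 ≤ r * b) {C j₀ : ℕ} (hbC : 9 * C + 66 ≤ b) (hj1 : 1 ≤ j₀) (hjm : j₀ ≤ m)
    (hrj : r ^ j₀ * b ^ 3 ≤ 1) :
    ∃ (V : ℕ) (ω : Fin m × Fin (b ^ m) → Fin V), ∀ p₀ p₁ p₂ : ℝ, |p₂| ≤ 1 →
      ∀ s : Finset ℕ, (∀ l ∈ s, l < b ^ m ∧ |template r ω (l / (b : ℝ) ^ m)
        - (p₀ + p₁ * (l / (b : ℝ) ^ m) + p₂ * (l / (b : ℝ) ^ m) ^ 2)| ≤ C * (r / b) ^ m) →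
      s.card ≤ (2 * (11 * m + 4)) ^ m * b ^ j₀ := by
  have hm : 1 ≤ m := NeZero.one_le
  have hb0 : 0 < b := by omega
  have hbR : (1 : ℝ) ≤ b := by exact_mod_cast hb0
  have hbC' : (9 * C + 66 : ℝ) ≤ b := by exact_mod_cast hbC
  set D := 3 * C + 21 with hD
  set Z := (D + 1) * b ^ (3 * m) with hZ
  set q := 11 * m + 4 with hq
  have hwB : 1 ≤ (b : ℝ) ^ (2 * m) * (r / b) ^ m := by
    have : (b : ℝ) ^ (2 * m) * (r / b) ^ m = (r * b) ^ m := by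
      rw [pow_mul, ← mul_pow]; congr 1; field_simp
    rw [this]; exact one_le_pow₀ hrb
  have hunion : (m * b ^ m * (2 * Z + 1) ^ 3
      * (b * ((4 * ((C + 3 : ℕ) : ℝ) + 1) * r ^ j₀)) ^ q : ℝ) < 1 := by
    have h1 : (m : ℝ) ≤ b ^ m := by
      exact_mod_cast (Nat.lt_pow_self (by omega : 1 < b)).le
    have h2 : (2 * Z + 1 : ℝ) ≤ b ^ (3 * m + 1) := by
      have : (2 * Z + 1 : ℕ) ≤ b ^ (3 * m + 1) := by
        have hpos : 1 ≤ b ^ (3 * m) := Nat.one_le_pow _ _ hb0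
        rw [hZ, hD, pow_succ]
        nlinarith
      exact_mod_cast this
    set X : ℝ := b * ((4 * ((C + 3 : ℕ) : ℝ) + 1) * r ^ j₀) with hX
    have hX0 : 0 ≤ X := by positivity
    have h3 : X * b ≤ 1 := by
      have : (4 * ((C + 3 : ℕ) : ℝ) + 1) ≤ b := by push_cast; linarith
      calc X * b ≤ b * (b * r ^ j₀) * b := by rw [hX]; gcongr
        _ = r ^ j₀ * b ^ 3 := by ring
        _ ≤ 1 := hrj
    have h4 : X ^ q * b ^ q ≤ 1 := by rw [← mul_pow]; exact pow_le_one₀ (by positivity) h3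
    calc (m * b ^ m * (2 * Z + 1) ^ 3 * X ^ q : ℝ)
        ≤ b ^ m * b ^ m * (b ^ (3 * m + 1)) ^ 3 * X ^ q := by gcongr
      _ = (X ^ q * b ^ q) / b := by
          rw [hq]
          have : (b : ℝ) ≠ 0 := by positivity
          field_simp
          ring
      _ ≤ 1 / b := by gcongr
      _ < 1 := by
          rw [div_lt_one (by positivity)]
          linarith [(Nat.cast_nonneg C : (0 : ℝ) ≤ C)]
  obtain ⟨ω, hω⟩ := exists_coef_few_children (b := b) (m := m) (V := b ^ (2 * m))
    (C := C + 3) (q := q) (Z := Z) (by omega) hbe hr (hr1.trans (by norm_num)) hj1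
    (by exact_mod_cast hwB) hunion
  refine ⟨_, ω, fun p₀ p₁ p₂ hp₂ s hs => ?_⟩
  classical
  rcases Nat.lt_or_ge 1 s.card with hs1 | hs1
  swap
  · exact hs1.trans (Nat.one_le_iff_ne_zero.2 (by positivity))
  obtain ⟨l, hl, l', hl', hne⟩ := Finset.one_lt_card.1 hs1
  have hq0 : 0 < r / b := by positivity
  have hqh : r / b ≤ 1 / 2 := (div_le_self hr.le hbR).trans hr1
  have hw1 : (r / b) ^ m ≤ 1 := pow_le_one₀ hq0.le (by linarith)
  have hy : ∀ l ∈ s, (0 : ℝ) ≤ l / (b : ℝ) ^ m ∧ (l / (b : ℝ) ^ m : ℝ) ≤ 1 := by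
    intro l hl
    refine ⟨by positivity, div_le_one_of_le₀ ?_ (by positivity)⟩
    exact_mod_cast (hs l hl).1.le
  have hP : ∀ l ∈ s, |p₀ + p₁ * (l / (b : ℝ) ^ m) + p₂ * (l / (b : ℝ) ^ m) ^ 2| ≤ C + 6 := by
    intro l hl
    have h1 := abs_le.1 (hs l hl).2
    have h2 := abs_le.1 (abs_template_le hr.le hqh ω (l / (b : ℝ) ^ m))
    have h3 : (C : ℝ) * (r / b) ^ m ≤ C := mul_le_of_le_one_right (by positivity) hw1
    rw [abs_le]
    constructor <;> linarith [h1.1, h1.2, h2.1, h2.2]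
  have hbm : (1 : ℝ) ≤ (b : ℝ) ^ m := one_le_pow₀ hbR
  have hp₁ : |p₁| ≤ 2 * (C + 6) * b ^ m + 2 := by
    set y := (l : ℝ) / (b : ℝ) ^ m with hydef
    set y' := (l' : ℝ) / (b : ℝ) ^ m with hydef'
    have hyy : 1 ≤ |y - y'| * b ^ m := by
      rw [hydef, hydef', ← sub_div, abs_div, abs_of_pos (by positivity : (0 : ℝ) < (b : ℝ) ^ m),
        div_mul_cancel₀ _ (by positivity)]
      have : (1 : ℤ) ≤ |(l : ℤ) - l'| := Int.one_le_abs (by omega)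
      exact_mod_cast this
    have e : (p₁ + p₂ * (y + y')) * (y - y') = (p₀ + p₁ * y + p₂ * y ^ 2)
        - (p₀ + p₁ * y' + p₂ * y' ^ 2) := by ring
    have h1 : |p₁ + p₂ * (y + y')| * |y - y'| ≤ 2 * (C + 6) := by
      rw [← abs_mul, e]
      exact (abs_sub _ _).trans (by linarith [hP l hl, hP l' hl'])
    have h2 : |p₁ + p₂ * (y + y')| ≤ 2 * (C + 6) * b ^ m := by
      calc |p₁ + p₂ * (y + y')| ≤ |p₁ + p₂ * (y + y')| * (|y - y'| * b ^ m) :=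
            le_mul_of_one_le_right (abs_nonneg _) hyy
        _ = |p₁ + p₂ * (y + y')| * |y - y'| * b ^ m := by ring
        _ ≤ _ := by gcongr
    have h3 : |p₂ * (y + y')| ≤ 2 := by
      rw [abs_mul, abs_of_nonneg (add_nonneg (hy l hl).1 (hy l' hl').1)]
      nlinarith [(hy l hl).1, (hy l' hl').1, (hy l hl).2, (hy l' hl').2, abs_nonneg p₂]
    have h4 := abs_sub (p₁ + p₂ * (y + y')) (p₂ * (y + y'))
    rw [add_sub_cancel_right] at h4
    linarith
  have hp₀ : |p₀| ≤ C + 6 + |p₁| + 1 := by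
    set y := (l : ℝ) / (b : ℝ) ^ m with hydef
    have h1 : |p₁ * y| ≤ |p₁| := by
      rw [abs_mul, abs_of_nonneg (hy l hl).1]
      exact mul_le_of_le_one_right (abs_nonneg _) (hy l hl).2
    have h2 : |p₂ * y ^ 2| ≤ 1 := by
      rw [abs_mul, abs_of_nonneg (sq_nonneg y)]
      exact mul_le_one₀ hp₂ (sq_nonneg _) (pow_le_one₀ (hy l hl).1 (hy l hl).2)
    have h3 := abs_le.1 (hP l hl)
    have h1' := abs_le.1 h1
    have h2' := abs_le.1 h2
    rw [abs_le]
    constructor <;> linarith [h1'.1, h1'.2, h2'.1, h2'.2, h3.1, h3.2]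
  have hDb : ∀ p : ℝ, |p| ≤ D * b ^ m → round (p * (b : ℝ) ^ (2 * m)) ∈ Finset.Icc (-Z : ℤ) Z := by
    intro p hp
    have := round_mem_Icc (K := b ^ (2 * m)) (Z := Z) hp (by
      have h1 : (1 : ℝ) ≤ (b : ℝ) ^ (3 * m) := one_le_pow₀ hbR
      rw [hZ]; push_cast
      have : (b : ℝ) ^ (3 * m) = b ^ m * b ^ (2 * m) := by ring
      nlinarith)
    simpa using this
  have hC0 : (0 : ℝ) ≤ C := Nat.cast_nonneg C
  have hDR : (D : ℝ) = 3 * C + 21 := by rw [hD]; push_cast; ring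
  set a : ℤ × ℤ × ℤ := (round (p₀ * (b : ℝ) ^ (2 * m)), round (p₁ * (b : ℝ) ^ (2 * m)),
      round (p₂ * (b : ℝ) ^ (2 * m))) with ha
  have hamem : a ∈ Finset.Icc (-Z : ℤ) Z ×ˢ Finset.Icc (-Z : ℤ) Z ×ˢ Finset.Icc (-Z : ℤ) Z := by
    simp only [ha, Finset.mem_product]
    refine ⟨hDb _ ?_, hDb _ ?_, hDb _ ?_⟩ <;> rw [hDR] <;> nlinarith
  have hcount := card_contact_le (r := r) (τ := ((C + 3 : ℕ) : ℝ) * (r / b) ^ m)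
    (P := netQuadratic b m a) (ω := ω) hjm (by omega : 1 ≤ q)
    (fun κ h1 h2 i hi S hS hpar => hω κ h1 h2 i hi a hamem S hS hpar)
  refine le_trans (Finset.card_le_card fun l hl => ?_) hcount
  rw [Finset.mem_filter, Finset.mem_range]
  refine ⟨(hs l hl).1, ?_⟩
  have h1 := abs_netQuadratic_round_sub_le (b := b) (m := m) p₀ p₁ p₂ (hy l hl).1 (hy l hl).2
  have h2 : 3 / (b : ℝ) ^ (2 * m) ≤ 3 * (r / b) ^ m := by
    rw [div_le_iff₀ (by positivity)]; linarith
  have h3 := abs_le.1 (hs l hl).2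
  have h4 := abs_le.1 (h1.trans h2)
  rw [abs_le]
  push_cast
  constructor <;> linarith [h3.1, h3.2, h4.1, h4.2]

end TemplateCount

lemma summable_and_abs_tsum_sub_le {x : ℝ} (h0 : 0 ≤ x) (h1 : x ≤ 1 / 2) {g : ℕ → ℝ}
    (hg : ∀ n, |g n| ≤ 3 * x ^ n) :
    Summable g ∧ ∀ M, |∑' n, g n - ∑ n ∈ Finset.range M, g n| ≤ 6 * x ^ M := by
  have hx : Summable fun n : ℕ => 3 * x ^ n :=
    (summable_geometric_of_lt_one h0 (by linarith)).mul_left 3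
  have hs : Summable g := Summable.of_norm_bounded hx hg
  refine ⟨hs, fun M => ?_⟩
  rw [← hs.sum_add_tsum_nat_add M, add_sub_cancel_left]
  have hgeo : HasSum (fun n : ℕ => 3 * x ^ M * x ^ n) (3 * x ^ M * (1 - x)⁻¹) :=
    (hasSum_geometric_of_lt_one h0 (by linarith)).mul_left _
  have htail : ∀ n, ‖g (n + M)‖ ≤ 3 * x ^ M * x ^ n := fun n =>
    (hg (n + M)).trans_eq (by rw [pow_add]; ring)
  refine (tsum_of_norm_bounded hgeo htail).trans ?_
  have : (1 - x)⁻¹ ≤ 2 := by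
    rw [inv_le_comm₀ (by linarith) (by norm_num)]; linarith
  nlinarith [pow_nonneg h0 M]

lemma geom_sum_le_pow {x : ℝ} (hx : 2 ≤ x) (n : ℕ) : ∑ k ∈ Finset.range n, x ^ k ≤ x ^ n := by
  induction n with
  | zero => simp
  | succ n ih =>
    rw [Finset.sum_range_succ, pow_succ]
    nlinarith [pow_nonneg (by linarith : (0 : ℝ) ≤ x) n]

section Lacunary

/-- The sum of the first `M` spline levels. -/
noncomputable def lacSum (b : ℕ) (r : ℝ) (c : ℕ → ℤ → ℝ) (M : ℕ) (x : ℝ) : ℝ :=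
  ∑ n ∈ Finset.range M, (r / b) ^ n * spline (b ^ n) (c n) (b ^ n * x)

/-- The termwise derivative of `lacSum`. -/
noncomputable def lacSumDeriv (b : ℕ) (r : ℝ) (c : ℕ → ℤ → ℝ) (M : ℕ) (x : ℝ) : ℝ :=
  ∑ n ∈ Finset.range M, r ^ n * splineDeriv (b ^ n) (c n) (b ^ n * x)

/-- The sum of all spline levels. -/
noncomputable def lac (b : ℕ) (r : ℝ) (c : ℕ → ℤ → ℝ) (x : ℝ) : ℝ :=
  ∑' n, (r / b) ^ n * spline (b ^ n) (c n) (b ^ n * x)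

/-- The derivative of `lac`. -/
noncomputable def lacDeriv (b : ℕ) (r : ℝ) (c : ℕ → ℤ → ℝ) (x : ℝ) : ℝ :=
  ∑' n, r ^ n * splineDeriv (b ^ n) (c n) (b ^ n * x)

variable {b : ℕ} {r : ℝ} {c : ℕ → ℤ → ℝ}

lemma hasDerivAt_lac_term (hb : 0 < b) (n : ℕ) (x : ℝ) :
    HasDerivAt (fun x => (r / b) ^ n * spline (b ^ n) (c n) (b ^ n * x))
      (r ^ n * splineDeriv (b ^ n) (c n) (b ^ n * x)) x := by
  have hbR : (b : ℝ) ≠ 0 := by exact_mod_cast hb.ne'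
  have h1 : HasDerivAt (fun x : ℝ => (b : ℝ) ^ n * x) ((b : ℝ) ^ n) x := by
    simpa using (hasDerivAt_id x).const_mul ((b : ℝ) ^ n)
  refine (((hasDerivAt_spline (b ^ n) (c n) (b ^ n * x)).comp x h1).const_mul
    ((r / b) ^ n)).congr_deriv ?_
  rw [div_pow]; field_simp

lemma abs_lac_term_le (hr : 0 < r) (hc : ∀ n j, |c n j| ≤ 1) (n : ℕ) (x : ℝ) :
    |(r / b) ^ n * spline (b ^ n) (c n) (b ^ n * x)| ≤ 3 * (r / b) ^ n := by
  rw [abs_mul, abs_of_nonneg (by positivity : 0 ≤ (r / b) ^ n), mul_comm]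
  gcongr
  exact abs_spline_le (hc n) _ _

lemma abs_lacDeriv_term_le (hr : 0 < r) (hc : ∀ n j, |c n j| ≤ 1) (n : ℕ) (x : ℝ) :
    |r ^ n * splineDeriv (b ^ n) (c n) (b ^ n * x)| ≤ 3 * r ^ n := by
  rw [abs_mul, abs_of_nonneg (by positivity : 0 ≤ r ^ n), mul_comm]
  gcongr
  exact abs_splineDeriv_le (hc n) _ _

lemma abs_lac_sub_le (hb : 0 < b) (hr : 0 < r) (hr1 : r ≤ 1 / 2) (hc : ∀ n j, |c n j| ≤ 1)
    (M : ℕ) (x : ℝ) : |lac b r c x - lacSum b r c M x| ≤ 6 * (r / b) ^ M := by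
  have hbR : (1 : ℝ) ≤ b := by exact_mod_cast hb
  exact (summable_and_abs_tsum_sub_le (by positivity) ((div_le_self hr.le hbR).trans hr1)
    fun n => abs_lac_term_le hr hc n x).2 M

lemma abs_lacDeriv_sub_le (hr : 0 < r) (hr1 : r ≤ 1 / 2) (hc : ∀ n j, |c n j| ≤ 1)
    (M : ℕ) (x : ℝ) : |lacDeriv b r c x - lacSumDeriv b r c M x| ≤ 6 * r ^ M :=
  (summable_and_abs_tsum_sub_le hr.le hr1 fun n => abs_lacDeriv_term_le hr hc n x).2 M

lemma hasDerivAt_lac (hb : 0 < b) (hr : 0 < r) (hr1 : r ≤ 1 / 2) (hc : ∀ n j, |c n j| ≤ 1)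
    (x : ℝ) : HasDerivAt (lac b r c) (lacDeriv b r c x) x := by
  have hbR : (1 : ℝ) ≤ b := by exact_mod_cast hb
  refine hasDerivAt_tsum (u := fun n => 3 * r ^ n)
    ((summable_geometric_of_lt_one hr.le (by linarith)).mul_left 3)
    (fun n y => hasDerivAt_lac_term hb n y) (fun n y => abs_lacDeriv_term_le hr hc n y)
    (y₀ := 0) ?_ x
  exact (summable_and_abs_tsum_sub_le (by positivity) ((div_le_self hr.le hbR).trans hr1)
    fun n => abs_lac_term_le hr hc n 0).1

lemma abs_lacSumDeriv_sub_le (hr : 0 < r) (hrb : 2 ≤ r * b) (hc : ∀ n j, |c n j| ≤ 1)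
    (M : ℕ) (x y : ℝ) :
    |lacSumDeriv b r c M x - lacSumDeriv b r c M y| ≤ 48 * (r * b) ^ M * |x - y| := by
  unfold lacSumDeriv
  rw [← Finset.sum_sub_distrib]
  calc _ ≤ ∑ n ∈ Finset.range M, |r ^ n * splineDeriv (b ^ n) (c n) (b ^ n * x)
          - r ^ n * splineDeriv (b ^ n) (c n) (b ^ n * y)| := Finset.abs_sum_le_sum_abs _ _
    _ ≤ ∑ n ∈ Finset.range M, (r * b) ^ n * (48 * |x - y|) := by
        refine Finset.sum_le_sum fun n _ => ?_
        rw [← mul_sub, abs_mul, abs_of_nonneg (by positivity : 0 ≤ r ^ n)]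
        calc _ ≤ r ^ n * (48 * |(b : ℝ) ^ n * x - b ^ n * y|) := by
              gcongr; exact abs_splineDeriv_sub_le (hc n) _ _ _
          _ = _ := by
              rw [← mul_sub, abs_mul, abs_of_nonneg (by positivity : (0 : ℝ) ≤ (b : ℝ) ^ n),
                mul_pow]
              ring
    _ = (∑ n ∈ Finset.range M, (r * b) ^ n) * (48 * |x - y|) := by rw [Finset.sum_mul]
    _ ≤ (r * b) ^ M * (48 * |x - y|) := by gcongr; exact geom_sum_le_pow hrb M
    _ = _ := by ring

lemma abs_lacDeriv_sub_lacDeriv_le (hb : 0 < b) (hr : 0 < r) (hr1 : r ≤ 1 / 2)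
    (hrb : 2 ≤ r * b) (hc : ∀ n j, |c n j| ≤ 1) (M : ℕ) {x y : ℝ}
    (hxy : |x - y| ≤ ((b : ℝ)⁻¹) ^ M) : |lacDeriv b r c x - lacDeriv b r c y| ≤ 60 * r ^ M := by
  have hbR : (0 : ℝ) < b := by exact_mod_cast hb
  have h1 := abs_le.1 (abs_lacDeriv_sub_le (b := b) hr hr1 hc M x)
  have h2 := abs_le.1 (abs_lacDeriv_sub_le (b := b) hr hr1 hc M y)
  have h3 : |lacSumDeriv b r c M x - lacSumDeriv b r c M y| ≤ 48 * r ^ M := by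
    refine (abs_lacSumDeriv_sub_le hr hrb hc M x y).trans ?_
    calc _ ≤ 48 * (r * b) ^ M * ((b : ℝ)⁻¹) ^ M := by gcongr
      _ = 48 * r ^ M := by rw [mul_assoc, ← mul_pow]; congr 2; field_simp
  have h3' := abs_le.1 h3
  rw [abs_le]
  constructor <;> linarith [h1.1, h1.2, h2.1, h2.2, h3'.1, h3'.2]

/-- On an interval of level `N` the first `N` levels add up to a quadratic polynomial. -/
lemma exists_quadratic_lacSum [NeZero b] (hr : 0 < r) (hrb : 2 ≤ r * b)
    (hc : ∀ n j, c n j ∈ Icc (0 : ℝ) 1) {N i : ℕ} (hi : i < b ^ N) :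
    ∃ q₀ q₁ q₂ : ℝ, |q₂| ≤ (r / b) ^ N ∧ ∀ y : ℝ, 0 ≤ y → y ≤ 1 →
      lacSum b r c N ((i + y) / (b : ℝ) ^ N) = q₀ + q₁ * y + q₂ * y ^ 2 := by
  have hb : 0 < b := NeZero.pos b
  have hbR : (0 : ℝ) < b := by exact_mod_cast hb
  have hterm : ∀ n, ∃ q₀ q₁ q₂ : ℝ, n < N → |q₂| ≤ ((b : ℝ) ^ n / (b : ℝ) ^ N) ^ 2 ∧
      ∀ y : ℝ, 0 ≤ y → y ≤ 1 →
      spline (b ^ n) (c n) (b ^ n * ((i + y) / (b : ℝ) ^ N)) = q₀ + q₁ * y + q₂ * y ^ 2 := by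
    intro n
    by_cases hn : n < N
    swap
    · exact ⟨0, 0, 0, fun h => absurd h hn⟩
    obtain ⟨ha, h1, -⟩ := block_bounds (b := b) hn.le hi
    set a := i / b ^ (N - n) with hadef
    obtain ⟨p₀, p₁, p₂, hp, hq⟩ := exists_quadratic_spline (K := b ^ n) (c := c n) (hc n)
      (a := a) (by positivity) (by exact_mod_cast ha)
    have hpow : (b : ℝ) ^ N = b ^ n * b ^ (N - n) := by rw [← pow_add]; congr 1; omega
    set e := (b : ℝ) ^ n / (b : ℝ) ^ N with he
    refine ⟨p₀ + p₁ * (e * i) + p₂ * (e * i) ^ 2, p₁ * e + 2 * p₂ * (e * i) * e, p₂ * e ^ 2,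
      fun _ => ⟨?_, fun y hy0 hy1 => ?_⟩⟩
    · rw [abs_mul, abs_of_nonneg (by positivity : 0 ≤ e ^ 2)]
      exact mul_le_of_le_one_left (by positivity) hp
    · have hz : (b : ℝ) ^ n * ((i + y) / (b : ℝ) ^ N) = e * i + e * y := by
        rw [he]; field_simp
      have he0 : 0 < e := by positivity
      have heinv : e * (b : ℝ) ^ (N - n) = 1 := by rw [he, hpow]; field_simp
      rw [hq]
      · rw [hz]; ring
      · rw [hz]
        have : (b : ℝ) ^ n * (i / (b : ℝ) ^ N) = e * i := by rw [he]; field_simp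
        rw [this] at h1
        push_cast
        nlinarith
      · rw [hz]
        have hlt : i + 1 ≤ (a + 1) * b ^ (N - n) := by
          rw [add_mul, one_mul]
          exact Nat.lt_div_mul_add (by positivity)
        have hlt' : (i + 1 : ℝ) ≤ (a + 1) * (b : ℝ) ^ (N - n) := by exact_mod_cast hlt
        push_cast
        calc e * i + e * y ≤ e * (i + 1) := by nlinarith
          _ ≤ e * ((a + 1) * (b : ℝ) ^ (N - n)) := by gcongr
          _ = (a + 1) * (e * (b : ℝ) ^ (N - n)) := by ring
          _ = a + 1 := by rw [heinv, mul_one]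
  choose q₀ q₁ q₂ hq using hterm
  refine ⟨∑ n ∈ Finset.range N, (r / b) ^ n * q₀ n, ∑ n ∈ Finset.range N, (r / b) ^ n * q₁ n,
    ∑ n ∈ Finset.range N, (r / b) ^ n * q₂ n, ?_, fun y hy0 hy1 => ?_⟩
  · calc _ ≤ ∑ n ∈ Finset.range N, |(r / b) ^ n * q₂ n| := Finset.abs_sum_le_sum_abs _ _
      _ ≤ ∑ n ∈ Finset.range N, (r * b) ^ n * ((1 / (b : ℝ) ^ N) ^ 2) := by
          refine Finset.sum_le_sum fun n hn => ?_
          rw [abs_mul, abs_of_nonneg (by positivity : 0 ≤ (r / b) ^ n)]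
          calc _ ≤ (r / b) ^ n * ((b : ℝ) ^ n / (b : ℝ) ^ N) ^ 2 := by
                gcongr; exact (hq n (Finset.mem_range.1 hn)).1
            _ = _ := by rw [div_pow, mul_pow]; field_simp
      _ = (∑ n ∈ Finset.range N, (r * b) ^ n) * ((1 / (b : ℝ) ^ N) ^ 2) := by rw [Finset.sum_mul]
      _ ≤ (r * b) ^ N * ((1 / (b : ℝ) ^ N) ^ 2) := by gcongr; exact geom_sum_le_pow hrb N
      _ = _ := by rw [div_pow r, mul_pow]; field_simp
  · unfold lacSum
    rw [Finset.sum_mul, Finset.sum_mul, ← Finset.sum_add_distrib, ← Finset.sum_add_distrib]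
    refine Finset.sum_congr rfl fun n hn => ?_
    rw [(hq n (Finset.mem_range.1 hn)).2 y hy0 hy1]
    ring

end Lacunary

section SelfSimilar

variable {b m V : ℕ} [NeZero b] [NeZero m]

/-- The coefficients repeat the levels of the template with period `m`. -/
noncomputable def selfSimilarCoef (ω : Fin m × Fin (b ^ m) → Fin V) (n : ℕ) (j : ℤ) : ℝ :=
  levelCoef ω (n % m) j

lemma selfSimilarCoef_mem (ω : Fin m × Fin (b ^ m) → Fin V) (n : ℕ) (j : ℤ) :
    selfSimilarCoef ω n j ∈ Icc (0 : ℝ) 1 := levelCoef_mem ω _ j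

lemma levelCoef_add_mul (ω : Fin m × Fin (b ^ m) → Fin V) (k : ℕ) (j i : ℤ) :
    levelCoef ω k (j + (b : ℤ) ^ k * i) = levelCoef ω k j := by
  unfold levelCoef
  rw [coefIndex_eq_of_modEq]
  push_cast
  exact Int.add_mul_emod_self_left _ _ _

lemma lacSum_leaf_eq (r : ℝ) (ω : Fin m × Fin (b ^ m) → Fin V) (t : ℕ) {i l : ℕ}
    (hi : i < b ^ (t * m)) (hl : l < b ^ m) :
    lacSum b r (selfSimilarCoef ω) (t * m + m) ((i + l / (b : ℝ) ^ m) / (b : ℝ) ^ (t * m))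
      = lacSum b r (selfSimilarCoef ω) (t * m) ((i + l / (b : ℝ) ^ m) / (b : ℝ) ^ (t * m))
        + (r / b) ^ (t * m) * template r ω (l / (b : ℝ) ^ m) := by
  have hb : 0 < b := NeZero.pos b
  have hbR : (0 : ℝ) < b := by exact_mod_cast hb
  set N := t * m with hN
  unfold lacSum template
  rw [Finset.sum_range_add, Finset.mul_sum]
  congr 1
  refine Finset.sum_congr rfl fun k hk => ?_
  have hkm := Finset.mem_range.1 hk
  have hcoef : selfSimilarCoef ω (N + k) = levelCoef ω k := by
    funext j
    unfold selfSimilarCoef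
    rw [hN, Nat.mul_add_mod', Nat.mod_eq_of_lt hkm]
  rw [hcoef, pow_add, mul_assoc]
  congr 2
  obtain ⟨h1, h2, h3⟩ := block_bounds (b := b) hkm.le hl
  set a := l / b ^ (m - k) with ha
  set y := (l : ℝ) / (b : ℝ) ^ m with hy
  have hz : (b : ℝ) ^ (N + k) * ((i + y) / (b : ℝ) ^ N) = b ^ k * i + b ^ k * y := by
    rw [pow_add]; field_simp
  rw [hz, spline_eq_three (K := b ^ k) (a := (a : ℤ)) (by positivity) (by exact_mod_cast h1)
    (by exact_mod_cast h2) (by exact_mod_cast h3),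
    spline_eq_three (K := b ^ (N + k)) (a := (a : ℤ) + (b : ℤ) ^ k * i) (by positivity)
    ?_ ?_ ?_]
  · have e1 : (a : ℤ) + (b : ℤ) ^ k * i - 1 = (a - 1) + (b : ℤ) ^ k * i := by ring
    have e2 : (a : ℤ) + (b : ℤ) ^ k * i + 1 = (a + 1) + (b : ℤ) ^ k * i := by ring
    rw [e1, e2, levelCoef_add_mul, levelCoef_add_mul, levelCoef_add_mul]
    push_cast
    rw [show (b : ℝ) ^ k * i + b ^ k * y - (a + b ^ k * i) = b ^ k * y - a by ring]
  · have : a + b ^ k * i < b ^ (N + k) := by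
      have : b ^ k * (i + 1) ≤ b ^ k * b ^ N := Nat.mul_le_mul_left _ hi
      rw [pow_add]; linarith
    exact_mod_cast this
  · push_cast; linarith
  · push_cast; linarith

end SelfSimilar

section FewTangents

variable {b : ℕ} {r : ℝ} {c : ℕ → ℤ → ℝ}

/-- A line which nearly passes through two points of the graph of `lac` over a short interval
nearly passes through the graph of the partial sum over all points of the interval. -/
lemma abs_lacSum_sub_line_le (hb : 0 < b) (hr : 0 < r) (hr1 : r ≤ 1 / 2)
    (hrb : 2 ≤ r * b) (hc : ∀ n j, |c n j| ≤ 1) {M : ℕ} {x y u v h s : ℝ}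
    (hxy : y - x ≤ ((b : ℝ)⁻¹) ^ M) (hu : u ∈ Icc x y) (hv : v ∈ Icc x y) (huv : u < v)
    (hline : |lac b r c u - (h + s * u)| ≤ (r / b) ^ M)
    (hslope : |(lac b r c v - lac b r c u) / (v - u) - s| ≤ r ^ M) :
    |lacSum b r c M x - (h + s * x)| ≤ 68 * (r / b) ^ M := by
  have hbR : (0 : ℝ) < b := by exact_mod_cast hb
  have hder := hasDerivAt_lac (c := c) hb hr hr1 hc
  obtain ⟨w, hw, hwd⟩ := exists_hasDerivAt_eq_slope (lac b r c) (lacDeriv b r c) huv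
    (fun z _ => (hder z).continuousAt.continuousWithinAt) fun z _ => hder z
  rw [← hwd] at hslope
  have hbound : ∀ z ∈ Icc x y, ‖lacDeriv b r c z - s‖ ≤ 61 * r ^ M := by
    intro z hz
    have hzw : |z - w| ≤ ((b : ℝ)⁻¹) ^ M := by
      rw [abs_le]
      constructor <;> linarith [hz.1, hz.2, hw.1, hw.2, hu.1, hu.2, hv.1, hv.2]
    have h1 := abs_le.1 (abs_lacDeriv_sub_lacDeriv_le hb hr hr1 hrb hc M hzw)
    have h2 := abs_le.1 hslope
    rw [Real.norm_eq_abs, abs_le]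
    constructor <;> linarith [h1.1, h1.2, h2.1, h2.2]
  have hx : x ∈ Icc x y := ⟨le_rfl, hu.1.trans hu.2⟩
  have hmv := Convex.norm_image_sub_le_of_norm_hasDerivWithin_le
    (f := fun z => lac b r c z - s * z) (f' := fun z => lacDeriv b r c z - s) (C := 61 * r ^ M)
    (s := Icc x y) (x := u) (y := x)
    (fun z _ => ((hder z).sub (by simpa using (hasDerivAt_id z).const_mul s)).hasDerivWithinAt)
    hbound (convex_Icc x y) hu hx
  have hxu : ‖x - u‖ ≤ ((b : ℝ)⁻¹) ^ M := by
    rw [Real.norm_eq_abs, abs_le]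
    constructor <;> linarith [hu.1, hu.2]
  have hmv' : |lac b r c x - s * x - (lac b r c u - s * u)| ≤ 61 * (r / b) ^ M := by
    refine hmv.trans ?_
    calc 61 * r ^ M * ‖x - u‖ ≤ 61 * r ^ M * ((b : ℝ)⁻¹) ^ M := by gcongr
      _ = 61 * (r / b) ^ M := by rw [mul_assoc, ← mul_pow, div_eq_mul_inv]
  have h1 := abs_le.1 hmv'
  have h2 := abs_le.1 hline
  have h3 := abs_le.1 (abs_lac_sub_le hb hr hr1 hc M x)
  rw [abs_le]
  constructor <;> linarith [h1.1, h1.2, h2.1, h2.2, h3.1, h3.2]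

end FewTangents

lemma exists_parameters {α : ℝ} (h0 : 0 < α) (h1 : α < 1) (C : ℕ) :
    ∃ j₀ m b : ℕ, 1 ≤ j₀ ∧ j₀ ≤ m ∧ Even b ∧ C ≤ b ∧ 2 ≤ b ∧ (b : ℝ) ^ (-α) ≤ 1 / 2 ∧
      2 ≤ (b : ℝ) ^ (-α) * b ∧ ((b : ℝ) ^ (-α)) ^ j₀ * (b : ℝ) ^ 3 ≤ 1 ∧
      (((2 * (11 * m + 4)) ^ m * b ^ j₀ : ℕ) : ℝ) * ((b : ℝ) ^ (-α)) ^ m ≤ 1 := by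
  set j₀ := ⌈3 / α⌉₊ with hj₀
  have hj : 3 ≤ α * j₀ := by
    have := Nat.le_ceil (3 / α)
    rwa [div_le_iff₀ h0, mul_comm] at this
  set m := ⌈2 * j₀ / α⌉₊ with hm
  have hmα : 2 * j₀ ≤ α * m := by
    have := Nat.le_ceil (2 * j₀ / α)
    rwa [div_le_iff₀ h0, mul_comm _ α] at this
  have hj1 : 1 ≤ j₀ := Nat.one_le_ceil_iff.2 (by positivity)
  have hj0R : (0 : ℝ) ≤ j₀ := Nat.cast_nonneg _
  have hjm : j₀ ≤ m := by
    have : (j₀ : ℝ) ≤ m := by nlinarith [(Nat.cast_nonneg m : (0 : ℝ) ≤ m)]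
    exact_mod_cast this
  have htend : Tendsto (fun n : ℕ => ((2 * n : ℕ) : ℝ)) atTop atTop :=
    tendsto_natCast_atTop_atTop.comp (tendsto_id.const_mul_atTop' (by norm_num))
  have e1 := ((tendsto_rpow_atTop h0).comp htend).eventually_ge_atTop 2
  have e2 := ((tendsto_rpow_atTop (by linarith : 0 < 1 - α)).comp htend).eventually_ge_atTop 2
  have e3 := ((tendsto_rpow_atTop (by linarith : 0 < α / 2)).comp htend).eventually_ge_atTop
    ((2 * (11 * m + 4) : ℕ) : ℝ)
  obtain ⟨n, ⟨⟨he1, he2⟩, he3⟩, he4⟩ :=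
    (((e1.and e2).and e3).and (eventually_ge_atTop (C + 1))).exists
  simp only [Function.comp] at he1 he2 he3
  set b := 2 * n with hb
  have hb2 : 2 ≤ b := by omega
  have hbR : (1 : ℝ) ≤ b := by exact_mod_cast (by omega : 1 ≤ b)
  have hb0 : (0 : ℝ) < b := by linarith
  refine ⟨j₀, m, b, hj1, hjm, even_two_mul n, by omega, hb2, ?_, ?_, ?_, ?_⟩
  · rw [Real.rpow_neg hb0.le, inv_le_comm₀ (by positivity) (by norm_num)]
    linarith
  · have : (b : ℝ) ^ (-α) * b = (b : ℝ) ^ (1 - α) := by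
      rw [sub_eq_neg_add, Real.rpow_add hb0, Real.rpow_one]
    rw [this]; exact he2
  · rw [← Real.rpow_natCast, ← Real.rpow_natCast, ← Real.rpow_mul hb0.le, ← Real.rpow_add hb0]
    refine Real.rpow_le_one_of_one_le_of_nonpos hbR ?_
    push_cast; linarith
  · have k1 : (((2 * (11 * m + 4)) ^ m : ℕ) : ℝ) ≤ (b : ℝ) ^ (α / 2 * m) := by
      rw [Real.rpow_mul hb0.le, Real.rpow_natCast]
      push_cast at he3 ⊢
      gcongr
    have k2 : ((b ^ j₀ : ℕ) : ℝ) ≤ (b : ℝ) ^ (α / 2 * m) := by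
      push_cast
      rw [← Real.rpow_natCast]
      exact Real.rpow_le_rpow_of_exponent_le hbR (by linarith)
    rw [← Real.rpow_natCast ((b : ℝ) ^ (-α)), ← Real.rpow_mul hb0.le]
    rw [Nat.cast_mul]
    calc _ ≤ (b : ℝ) ^ (α / 2 * m) * (b : ℝ) ^ (α / 2 * m) * (b : ℝ) ^ (-α * m) := by gcongr
      _ = 1 := by
        rw [← Real.rpow_add hb0, ← Real.rpow_add hb0]
        rw [show α / 2 * m + α / 2 * m + -α * m = 0 by ring, Real.rpow_zero]

/-- The graph of `f` over an interval `[i R^(-t), (i+1) R^(-t)]` is nearly tangent to a line over at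
most `1 / ρ` of the `R` subintervals of the next level. -/
def FewTangents (R : ℕ) (ρ : ℝ) (f : ℝ → ℝ) : Prop :=
  ∀ t i : ℕ, i < R ^ t → ∀ h s : ℝ, ∀ S : Finset ℕ,
    (∀ l ∈ S, l < R ∧ ∃ u v : ℝ, u < v ∧
      u ∈ Icc ((i + l / R : ℝ) / R ^ t) ((i + (l + 1) / R : ℝ) / R ^ t) ∧
      v ∈ Icc ((i + l / R : ℝ) / R ^ t) ((i + (l + 1) / R : ℝ) / R ^ t) ∧
      |f u - (h + s * u)| ≤ (ρ / R) ^ (t + 1) ∧ |(f v - f u) / (v - u) - s| ≤ ρ ^ (t + 1)) →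
    S.card * ρ ≤ 1

/-- There is a `C^(1+α)` function such that the graph over an interval of a level is nearly
tangent to a line over at most `R ^ α` of the `R` subintervals of the next level. -/
theorem exists_function_few_tangents {α : ℝ} (h0 : 0 < α) (h1 : α < 1) :
    ∃ (R : ℕ) (ρ C : ℝ) (f f' : ℝ → ℝ), 2 ≤ R ∧ ρ = (R : ℝ) ^ (-α) ∧
      (∀ x, HasDerivAt f (f' x) x) ∧ (∀ x, |f' x| ≤ C) ∧
      (∀ x y, x ≠ y → |x - y| ≤ 1 → |f' x - f' y| ≤ C * |x - y| ^ α) ∧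
      FewTangents R ρ f := by
  obtain ⟨j₀, m, b, hj1, hjm, hbe, hbC, hb2, hr1, hrb, hrj, hK⟩ :=
    exists_parameters h0 h1 (9 * 68 + 66)
  have hb0 : 0 < b := by omega
  have : NeZero b := ⟨hb0.ne'⟩
  have : NeZero m := ⟨by omega⟩
  have hbR1 : (1 : ℝ) ≤ b := by exact_mod_cast hb0
  have hbR : (0 : ℝ) < b := by linarith
  set r := (b : ℝ) ^ (-α) with hrdef
  have hr : 0 < r := by positivity
  obtain ⟨V, ω, hω⟩ := exists_template_few_contacts (b := b) (m := m) hbe hr hr1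
    (by linarith) (C := 68) hbC hj1 hjm hrj
  set c := selfSimilarCoef ω with hcdef
  have hc01 : ∀ n j, c n j ∈ Icc (0 : ℝ) 1 := selfSimilarCoef_mem ω
  have hc : ∀ n j, |c n j| ≤ 1 := fun n j => by
    rw [abs_of_nonneg (hc01 n j).1]; exact (hc01 n j).2
  refine ⟨b ^ m, r ^ m, max 6 (60 / r), lac b r c, lacDeriv b r c, ?_, ?_,
    hasDerivAt_lac hb0 hr hr1 hc, ?_, ?_, ?_⟩
  · exact hb2.trans (Nat.le_self_pow (by omega) b)
  · rw [hrdef, Nat.cast_pow, ← Real.rpow_natCast, ← Real.rpow_natCast, ← Real.rpow_mul hbR.le,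
      ← Real.rpow_mul hbR.le, mul_comm]
  · intro x
    refine le_trans ?_ (le_max_left _ _)
    simpa [lacSumDeriv] using abs_lacDeriv_sub_le (b := b) hr hr1 hc 0 x
  · intro x y hne hxy
    have hpos : 0 < |x - y| := abs_pos.2 (sub_ne_zero.2 hne)
    obtain ⟨M, hM1, hM2⟩ := exists_nat_pow_near_of_lt_one hpos hxy (inv_pos.2 hbR)
      (inv_lt_one_of_one_lt₀ (by exact_mod_cast hb2))
    refine (abs_lacDeriv_sub_lacDeriv_le hb0 hr hr1 hrb hc M hM2).trans ?_
    have hpow : r ^ (M + 1) ≤ |x - y| ^ α := by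
      have : r ^ (M + 1) = (((b : ℝ)⁻¹) ^ (M + 1)) ^ α := by
        rw [hrdef, Real.rpow_neg hbR.le, ← Real.inv_rpow hbR.le, ← Real.rpow_natCast,
          ← Real.rpow_natCast, ← Real.rpow_mul (by positivity), ← Real.rpow_mul (by positivity),
          mul_comm]
      rw [this]
      gcongr
    calc 60 * r ^ M = 60 / r * r ^ (M + 1) := by rw [pow_succ]; field_simp
      _ ≤ max 6 (60 / r) * |x - y| ^ α := by
          gcongr
          exact le_max_right _ _
  · intro t i hi h s S hS
    push_cast at hS ⊢
    set N := t * m with hN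
    have hiN : i < b ^ N := by rwa [hN, mul_comm, pow_mul]
    obtain ⟨q₀, q₁, q₂, hq₂, hq⟩ := exists_quadratic_lacSum hr hrb hc01 hiN
    set w := (r / b) ^ N with hw
    have hw0 : 0 < w := by positivity
    have hcount := hω ((h + s * (i / (b : ℝ) ^ N) - q₀) / w) ((s / (b : ℝ) ^ N - q₁) / w)
      (-q₂ / w) (by rw [abs_div, abs_neg, abs_of_pos hw0]; exact div_le_one_of_le₀ hq₂ hw0.le) S ?_
    · calc (S.card : ℝ) * r ^ m ≤ (((2 * (11 * m + 4)) ^ m * b ^ j₀ : ℕ) : ℝ) * r ^ m := by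
            gcongr
        _ ≤ 1 := hK
    · intro l hl
      obtain ⟨hlR, u, v, huv, hu, hv, hline, hslope⟩ := hS l hl
      refine ⟨hlR, ?_⟩
      have hM : m * (t + 1) = N + m := by rw [hN]; ring
      have hNpow : ((b : ℝ) ^ m) ^ t = (b : ℝ) ^ N := by rw [← pow_mul, hN, mul_comm]
      rw [← div_pow, ← pow_mul, hM] at hline
      rw [← pow_mul, hM] at hslope
      rw [hNpow] at hu hv
      have hlen : (i + (l + 1) / (b : ℝ) ^ m) / (b : ℝ) ^ N - (i + l / (b : ℝ) ^ m) / (b : ℝ) ^ N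
          ≤ ((b : ℝ)⁻¹) ^ (N + m) := by
        apply le_of_eq
        rw [inv_pow, pow_add]
        field_simp
        ring
      have key := abs_lacSum_sub_line_le hb0 hr hr1 hrb hc hlen hu hv huv hline hslope
      set y := (l : ℝ) / (b : ℝ) ^ m with hy
      have hy0 : 0 ≤ y := by positivity
      have hy1 : y ≤ 1 := by
        refine div_le_one_of_le₀ ?_ (by positivity)
        exact_mod_cast hlR.le
      rw [lacSum_leaf_eq r ω t hiN hlR, hq y hy0 hy1] at key
      have e : template r ω y - ((h + s * (i / (b : ℝ) ^ N) - q₀) / w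
          + (s / (b : ℝ) ^ N - q₁) / w * y + -q₂ / w * y ^ 2)
          = (q₀ + q₁ * y + q₂ * y ^ 2 + w * template r ω y
            - (h + s * ((i + y) / (b : ℝ) ^ N))) / w := by
        field_simp
        ring
      rw [e, abs_div, abs_of_pos hw0, div_le_iff₀ hw0]
      refine key.trans_eq ?_
      rw [hw, pow_add]; push_cast; ring

lemma RestrictionConvex.chord_le_chord {f : ℝ → ℝ} {A : Set ℝ} (hf : RestrictionConvex f A)
    {x y z : ℝ} (hx : x ∈ A) (hy : y ∈ A) (hz : z ∈ A) (hxy : x < y) (hyz : y < z) :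
    (f y - f x) / (y - x) ≤ (f z - f y) / (z - y) := by
  have h := hf x hx y hy z hz hxy hyz
  have h1 : 0 < y - x := sub_pos.2 hxy
  have h2 : 0 < z - y := sub_pos.2 hyz
  have h3 : 0 < z - x := by linarith
  rw [div_mul_eq_mul_div, div_mul_eq_mul_div, ← add_div, le_div_iff₀ h3] at h
  rw [div_le_div_iff₀ h1 h2]
  linarith

lemma RestrictionConvex.chord_le_chord_of_lt {f : ℝ → ℝ} {A : Set ℝ}
    (hf : RestrictionConvex f A) {p q p' q' : ℝ} (hp : p ∈ A) (hq : q ∈ A) (hp' : p' ∈ A)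
    (hq' : q' ∈ A) (hpq : p < q) (hqp' : q < p') (hpq' : p' < q') :
    (f q - f p) / (q - p) ≤ (f q' - f p') / (q' - p') :=
  (hf.chord_le_chord hp hq hp' hpq hqp').trans (hf.chord_le_chord hq hp' hq' hqp' hpq')

/-- A bound on the number of consecutive intervals of length at least `ε` in `[-C, B]`. -/
lemma card_mul_le_of_consecutive {lo hi : ℕ → ℝ} {ε C : ℝ} {E : Finset ℕ}
    (hlen : ∀ i ∈ E, ε ≤ hi i - lo i) (hlo : ∀ i ∈ E, -C ≤ lo i)
    (hlt : ∀ i ∈ E, ∀ j ∈ E, i < j → hi i ≤ lo j) {B : ℝ} (hB : -C ≤ B)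
    (hhi : ∀ i ∈ E, hi i ≤ B) : E.card * ε ≤ B + C := by
  induction E using Finset.induction_on_max generalizing B with
  | empty => simpa using by linarith
  | insert a s has ih =>
    have ha := Finset.mem_insert_self a s
    have hs : ∀ i ∈ s, i ∈ insert a s := fun i hi => Finset.mem_insert_of_mem hi
    have h1 := ih (fun i hi => hlen i (hs i hi)) (fun i hi => hlo i (hs i hi))
      (fun i hi j hj => hlt i (hs i hi) j (hs j hj)) (hlo a ha)
      (fun i hi => hlt i (hs i hi) a ha (has i hi))
    rw [Finset.card_insert_of_notMem fun h => lt_irrefl _ (has a h)]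
    push_cast
    linarith [hlen a ha, hhi a ha]

section Cells

open scoped Classical in
/-- The cells `[i R^(-t), (i+1) R^(-t))` which meet `A`. -/
noncomputable def cells (R t : ℕ) (A : Set ℝ) : Finset ℕ :=
  (Finset.range (R ^ t + 1)).filter fun i => ∃ x ∈ A, ⌊x * (R : ℝ) ^ t⌋₊ = i

open scoped Classical in
/-- The cells which contain two points of `A`. -/
noncomputable def pairCells (R t : ℕ) (A : Set ℝ) : Finset ℕ :=
  (Finset.range (R ^ t + 1)).filter fun i => ∃ u ∈ A, ∃ v ∈ A, u < v ∧
    ⌊u * (R : ℝ) ^ t⌋₊ = i ∧ ⌊v * (R : ℝ) ^ t⌋₊ = i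

open scoped Classical in
/-- The cells over which the slopes of the chords of `f|_A` vary by more than `ε`. -/
noncomputable def steepCells (R t : ℕ) (A : Set ℝ) (f : ℝ → ℝ) (ε : ℝ) : Finset ℕ :=
  (Finset.range (R ^ t + 1)).filter fun i => ∃ u ∈ A, ∃ v ∈ A, ∃ u' ∈ A, ∃ v' ∈ A,
    u < v ∧ u' < v' ∧ ⌊u * (R : ℝ) ^ t⌋₊ = i ∧ ⌊v * (R : ℝ) ^ t⌋₊ = i ∧
    ⌊u' * (R : ℝ) ^ t⌋₊ = i ∧ ⌊v' * (R : ℝ) ^ t⌋₊ = i ∧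
    ε < (f v' - f u') / (v' - u') - (f v - f u) / (v - u)

variable {R : ℕ} {A : Set ℝ}

lemma floor_le_pow (hA : A ⊆ Icc 0 1) (t : ℕ) {x : ℝ} (hx : x ∈ A) :
    ⌊x * (R : ℝ) ^ t⌋₊ < R ^ t + 1 := by
  have h : x * (R : ℝ) ^ t ≤ ((R ^ t : ℕ) : ℝ) := by
    push_cast
    exact mul_le_of_le_one_left (by positivity) (hA hx).2
  exact Nat.lt_succ_of_le (Nat.floor_le_of_le h)

lemma floor_succ_div (hR : 0 < R) (t : ℕ) (x : ℝ) :
    ⌊x * (R : ℝ) ^ (t + 1)⌋₊ / R = ⌊x * (R : ℝ) ^ t⌋₊ := by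
  have hR' : (R : ℝ) ≠ 0 := by exact_mod_cast hR.ne'
  rw [← Nat.floor_div_natCast, pow_succ]
  congr 1
  field_simp

lemma floor_bounds (hR : 0 < R) (hA : A ⊆ Icc 0 1) {t i : ℕ} {x : ℝ} (hx : x ∈ A)
    (h : ⌊x * (R : ℝ) ^ t⌋₊ = i) : (i : ℝ) ≤ x * (R : ℝ) ^ t ∧ x * (R : ℝ) ^ t < i + 1 := by
  have hR' : (0 : ℝ) < R := by exact_mod_cast hR
  have h0 : 0 ≤ x * (R : ℝ) ^ t := mul_nonneg (hA hx).1 (by positivity)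
  rw [← h]
  exact ⟨Nat.floor_le h0, Nat.lt_floor_add_one _⟩

lemma abs_sub_le_of_floor (hR : 0 < R) (hA : A ⊆ Icc 0 1) {t i : ℕ} {x y : ℝ} (hx : x ∈ A)
    (hy : y ∈ A) (h : ⌊x * (R : ℝ) ^ t⌋₊ = i) (h' : ⌊y * (R : ℝ) ^ t⌋₊ = i) :
    |x - y| * (R : ℝ) ^ t ≤ 1 := by
  have hR' : (0 : ℝ) < R := by exact_mod_cast hR
  obtain ⟨h1, h2⟩ := floor_bounds hR hA hx h
  obtain ⟨h3, h4⟩ := floor_bounds hR hA hy h'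
  have hp : (0 : ℝ) < (R : ℝ) ^ t := by positivity
  rw [← abs_of_pos hp, ← abs_mul, abs_le]
  constructor <;> linarith

lemma lt_of_floor_lt (hR : 0 < R) (t : ℕ) {x y : ℝ}
    (h : ⌊x * (R : ℝ) ^ t⌋₊ < ⌊y * (R : ℝ) ^ t⌋₊) : x < y := by
  by_contra! hle
  exact absurd (Nat.floor_mono (mul_le_mul_of_nonneg_right hle (by positivity :
    (0 : ℝ) ≤ (R : ℝ) ^ t))) (not_le.2 h)

lemma card_fiber_le (hR : 0 < R) (S : Finset ℕ) (i : ℕ) :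
    (S.filter fun j => j / R = i).card ≤ R := by
  have : (S.filter fun j => j / R = i) ⊆ Finset.Ico (i * R) ((i + 1) * R) := by
    intro j hj
    have hj' := (Finset.mem_filter.1 hj).2
    rw [Finset.mem_Ico, ← hj']
    refine ⟨Nat.div_mul_le_self _ _, ?_⟩
    rw [add_mul, one_mul]
    exact Nat.lt_div_mul_add hR
  refine (Finset.card_le_card this).trans ?_
  rw [Nat.card_Ico, add_mul, one_mul, Nat.add_sub_cancel_left]

lemma card_cells_succ_le (hR : 0 < R) (hA : A ⊆ Icc 0 1) (t : ℕ) :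
    (cells R (t + 1) A).card ≤ (cells R t A).card + R * (pairCells R t A).card := by
  classical
  have hmaps : ∀ j ∈ cells R (t + 1) A, j / R ∈ cells R t A := by
    intro j hj
    simp only [cells, Finset.mem_filter, Finset.mem_range] at hj ⊢
    obtain ⟨-, x, hx, rfl⟩ := hj
    rw [floor_succ_div hR]
    exact ⟨floor_le_pow hA t hx, x, hx, rfl⟩
  rw [Finset.card_eq_sum_card_fiberwise hmaps]
  have hfib : ∀ i ∈ cells R t A, ((cells R (t + 1) A).filter fun j => j / R = i).card
      ≤ 1 + if i ∈ pairCells R t A then R else 0 := by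
    intro i hi
    by_cases hp : i ∈ pairCells R t A
    · rw [if_pos hp]
      exact (card_fiber_le hR _ i).trans (by omega)
    · rw [if_neg hp, add_zero, Finset.card_le_one]
      have key : ∀ x ∈ A, ∀ y ∈ A, ⌊x * (R : ℝ) ^ (t + 1)⌋₊ / R = i →
          ⌊y * (R : ℝ) ^ (t + 1)⌋₊ / R = i → ¬ x < y := by
        intro x hx y hy hxi hyi hlt
        rw [floor_succ_div hR] at hxi hyi
        refine hp ?_
        simp only [pairCells, Finset.mem_filter, Finset.mem_range]
        exact ⟨hxi ▸ floor_le_pow hA t hx, x, hx, y, hy, hlt, hxi, hyi⟩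
      intro j hj j' hj'
      simp only [cells, Finset.mem_filter] at hj hj'
      obtain ⟨⟨-, x, hx, rfl⟩, hxi⟩ := hj
      obtain ⟨⟨-, y, hy, rfl⟩, hyi⟩ := hj'
      rw [le_antisymm (not_lt.1 (key y hy x hx hyi hxi)) (not_lt.1 (key x hx y hy hxi hyi))]
  refine (Finset.sum_le_sum hfib).trans ?_
  rw [Finset.sum_add_distrib, Finset.sum_ite_mem, Finset.sum_const, Finset.sum_const,
    smul_eq_mul, smul_eq_mul, mul_one, mul_comm]
  gcongr
  exact Finset.inter_subset_right

lemma card_steepCells_mul_le {f : ℝ → ℝ} (hf : RestrictionConvex f A) {C ε : ℝ} (hR : 0 < R)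
    (hC : ∀ u v : ℝ, u < v → |(f v - f u) / (v - u)| ≤ C) (t : ℕ) :
    (steepCells R t A f ε).card * ε ≤ 2 * C := by
  have hC0 : 0 ≤ C := (abs_nonneg _).trans (hC 0 1 one_pos)
  have hex : ∀ i, ∃ u v u' v' : ℝ, i ∈ steepCells R t A f ε → u ∈ A ∧ v ∈ A ∧ u' ∈ A ∧ v' ∈ A ∧
      u < v ∧ u' < v' ∧ ⌊u * (R : ℝ) ^ t⌋₊ = i ∧ ⌊v * (R : ℝ) ^ t⌋₊ = i ∧
      ⌊u' * (R : ℝ) ^ t⌋₊ = i ∧ ⌊v' * (R : ℝ) ^ t⌋₊ = i ∧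
      ε < (f v' - f u') / (v' - u') - (f v - f u) / (v - u) := by
    intro i
    by_cases hi : i ∈ steepCells R t A f ε
    · obtain ⟨-, u, hu, v, hv, u', hu', v', hv', h⟩ := by
        simpa only [steepCells, Finset.mem_filter] using hi
      exact ⟨u, v, u', v', fun _ => ⟨hu, hv, hu', hv', h⟩⟩
    · exact ⟨0, 0, 0, 0, fun h => absurd h hi⟩
  choose u v u' v' h using hex
  have := card_mul_le_of_consecutive (E := steepCells R t A f ε) (ε := ε) (C := C) (B := C)
    (lo := fun i => (f (v i) - f (u i)) / (v i - u i))
    (hi := fun i => (f (v' i) - f (u' i)) / (v' i - u' i)) ?_ ?_ ?_ (by linarith) ?_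
  · linarith
  · intro i hi
    obtain ⟨-, -, -, -, -, -, -, -, -, -, hε⟩ := h i hi
    exact hε.le
  · intro i hi
    obtain ⟨-, -, -, -, huv, -⟩ := h i hi
    exact (abs_le.1 (hC _ _ huv)).1
  · intro i hi j hj hij
    obtain ⟨-, -, hu', hv', -, huv', -, -, -, hvi, -⟩ := h i hi
    obtain ⟨hu, hv, -, -, huv, -, huj, -⟩ := h j hj
    refine hf.chord_le_chord_of_lt hu' hv' hu hv huv' (lt_of_floor_lt hR t ?_) huv
    rw [hvi, huj]; exact hij
  · intro i hi
    obtain ⟨-, -, -, -, -, huv', -⟩ := h i hi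
    exact (abs_le.1 (hC _ _ huv')).2

lemma FewTangents.neg {ρ : ℝ} {f : ℝ → ℝ} (hf : FewTangents R ρ f) :
    FewTangents R ρ (fun x => -f x) := by
  intro t i hi h s S hS
  refine hf t i hi (-h) (-s) S fun l hl => ?_
  obtain ⟨hlR, u, v, huv, hu, hv, h1, h2⟩ := hS l hl
  refine ⟨hlR, u, v, huv, hu, hv, ?_, ?_⟩
  · rw [← abs_neg]; convert h1 using 2; ring
  · rw [← abs_neg]; convert h2 using 2; ring

lemma card_pairCells_fiber_mul_le {f : ℝ → ℝ} {ρ : ℝ} (hf : FewTangents R ρ f) (hR : 0 < R)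
    (hρ : 0 < ρ) (hA : A ⊆ Icc 0 1) {t i : ℕ} (hi : i ∈ pairCells R t A)
    (hi' : i ∉ steepCells R t A f (ρ ^ t * (ρ / R))) :
    ((pairCells R (t + 1) A).filter fun j => j / R = i).card * ρ ≤ 1 := by
  classical
  have hRR : (0 : ℝ) < R := by exact_mod_cast hR
  have hR1 : (1 : ℝ) ≤ R := by exact_mod_cast hR
  set ε := ρ ^ t * (ρ / R) with hε
  have hε0 : 0 < ε := by positivity
  obtain ⟨hirange, u₀, hu₀, v₀, hv₀, huv₀, hui₀, hvi₀⟩ := by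
    simpa only [pairCells, Finset.mem_filter] using hi
  have hilt : i < R ^ t := by
    have h1 := (floor_bounds hR hA hu₀ hui₀).1
    have h2 : u₀ * (R : ℝ) ^ t < (R : ℝ) ^ t :=
      mul_lt_of_lt_one_left (by positivity) (huv₀.trans_le (hA hv₀).2)
    exact_mod_cast h1.trans_lt h2
  have hslope : ∀ u ∈ A, ∀ v ∈ A, u < v → ⌊u * (R : ℝ) ^ t⌋₊ = i → ⌊v * (R : ℝ) ^ t⌋₊ = i →
      |(f v - f u) / (v - u) - (f v₀ - f u₀) / (v₀ - u₀)| ≤ ε := by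
    intro u hu v hv huv hui hvi
    by_contra! hlt
    refine hi' ?_
    simp only [steepCells, Finset.mem_filter]
    refine ⟨hirange, ?_⟩
    rcases lt_abs.1 hlt with h | h
    · exact ⟨u₀, hu₀, v₀, hv₀, u, hu, v, hv, huv₀, huv, hui₀, hvi₀, hui, hvi, h⟩
    · exact ⟨u, hu, v, hv, u₀, hu₀, v₀, hv₀, huv, huv₀, hui, hvi, hui₀, hvi₀, by linarith⟩
  set s := (f v₀ - f u₀) / (v₀ - u₀) with hs
  have hline : ∀ u ∈ A, ⌊u * (R : ℝ) ^ t⌋₊ = i →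
      |f u - (f u₀ - s * u₀ + s * u)| ≤ (ρ / R) ^ (t + 1) := by
    intro u hu hui
    have hfac : |f u - (f u₀ - s * u₀ + s * u)| ≤ ε * |u - u₀| := by
      have e : f u - (f u₀ - s * u₀ + s * u) = (f u - f u₀) - s * (u - u₀) := by ring
      rw [e]
      rcases lt_trichotomy u u₀ with h | h | h
      · have h1 := hslope u hu u₀ hu₀ h hui hui₀
        have h2 : f u - f u₀ - s * (u - u₀)
            = ((f u₀ - f u) / (u₀ - u) - s) * (u - u₀) := by
          have : u₀ - u ≠ 0 := (sub_pos.2 h).ne'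
          field_simp
          ring
        rw [h2, abs_mul]
        gcongr
      · subst h; simp
      · have h1 := hslope u₀ hu₀ u hu h hui₀ hui
        have h2 : f u - f u₀ - s * (u - u₀)
            = ((f u - f u₀) / (u - u₀) - s) * (u - u₀) := by
          have : u - u₀ ≠ 0 := (sub_pos.2 h).ne'
          field_simp
        rw [h2, abs_mul]
        gcongr
    refine hfac.trans ?_
    have hd := abs_sub_le_of_floor hR hA hu hu₀ hui hui₀
    calc ε * |u - u₀| = (ρ / R) ^ (t + 1) * (|u - u₀| * (R : ℝ) ^ t) := by
          rw [hε, pow_succ, div_pow]; field_simp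
      _ ≤ (ρ / R) ^ (t + 1) := mul_le_of_le_one_right (by positivity) hd
  set S := ((pairCells R (t + 1) A).filter fun j => j / R = i).image fun j => j % R with hS
  have hcard : ((pairCells R (t + 1) A).filter fun j => j / R = i).card = S.card := by
    rw [hS, Finset.card_image_of_injOn]
    intro j hj j' hj' hjj
    have h1 := (Finset.mem_filter.1 hj).2
    have h2 := (Finset.mem_filter.1 hj').2
    rw [← Nat.div_add_mod j R, ← Nat.div_add_mod j' R, h1, h2]
    simp only at hjj
    rw [hjj]
  rw [hcard]
  refine hf t i hilt (f u₀ - s * u₀) s S fun l hl => ?_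
  obtain ⟨j, hj, rfl⟩ := Finset.mem_image.1 hl
  obtain ⟨hjp, hji⟩ := Finset.mem_filter.1 hj
  obtain ⟨-, u, hu, v, hv, huv, huj, hvj⟩ := by
    simpa only [pairCells, Finset.mem_filter] using hjp
  have hjdec : (j : ℝ) = i * R + (j % R : ℕ) := by
    have := Nat.div_add_mod j R
    rw [hji] at this
    rw [← this]
    push_cast
    rw [Nat.mul_add_mod, Nat.mod_mod]
    ring
  have hui : ⌊u * (R : ℝ) ^ t⌋₊ = i := by rw [← floor_succ_div hR, huj, hji]
  have hvi : ⌊v * (R : ℝ) ^ t⌋₊ = i := by rw [← floor_succ_div hR, hvj, hji]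
  have hmem : ∀ x ∈ A, ⌊x * (R : ℝ) ^ (t + 1)⌋₊ = j →
      x ∈ Icc ((i + (j % R : ℕ) / R : ℝ) / R ^ t) ((i + ((j % R : ℕ) + 1) / R : ℝ) / R ^ t) := by
    intro x hx hxj
    obtain ⟨h1, h2⟩ := floor_bounds hR hA hx hxj
    rw [hjdec, pow_succ] at h1 h2
    constructor
    · rw [div_le_iff₀ (by positivity), ← mul_le_mul_iff_left₀ hRR, add_mul, div_mul_cancel₀ _ hRR.ne']
      linarith
    · rw [le_div_iff₀ (by positivity), ← mul_le_mul_iff_left₀ hRR, add_mul,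
        div_mul_cancel₀ _ hRR.ne']
      linarith
  refine ⟨Nat.mod_lt _ hR, u, v, huv, hmem u hu huj, hmem v hv hvj, hline u hu hui, ?_⟩
  refine (hslope u hu v hv huv hui hvi).trans ?_
  rw [hε, pow_succ]
  gcongr
  exact div_le_self hρ.le hR1

lemma card_pairCells_succ_le {f : ℝ → ℝ} {ρ : ℝ} (hf : FewTangents R ρ f) (hR : 0 < R)
    (hρ : 0 < ρ) (hA : A ⊆ Icc 0 1) (t : ℕ) :
    ((pairCells R (t + 1) A).card : ℝ) ≤
      R * (steepCells R t A f (ρ ^ t * (ρ / R))).card + ρ⁻¹ * (pairCells R t A).card := by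
  classical
  have hmaps : ∀ j ∈ pairCells R (t + 1) A, j / R ∈ pairCells R t A := by
    intro j hj
    simp only [pairCells, Finset.mem_filter, Finset.mem_range] at hj ⊢
    obtain ⟨-, u, hu, v, hv, huv, huj, hvj⟩ := hj
    have hui : ⌊u * (R : ℝ) ^ t⌋₊ = j / R := by rw [← floor_succ_div hR, huj]
    have hvi : ⌊v * (R : ℝ) ^ t⌋₊ = j / R := by rw [← floor_succ_div hR, hvj]
    exact ⟨hui ▸ floor_le_pow hA t hu, u, hu, v, hv, huv, hui, hvi⟩
  rw [Finset.card_eq_sum_card_fiberwise hmaps]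
  push_cast
  set E := steepCells R t A f (ρ ^ t * (ρ / R)) with hE
  have hfib : ∀ i ∈ pairCells R t A,
      (((pairCells R (t + 1) A).filter fun j => j / R = i).card : ℝ)
        ≤ ρ⁻¹ + if i ∈ E then (R : ℝ) else 0 := by
    intro i hi
    by_cases hp : i ∈ E
    · rw [if_pos hp]
      have : (((pairCells R (t + 1) A).filter fun j => j / R = i).card : ℝ) ≤ R := by
        exact_mod_cast card_fiber_le hR _ i
      have := inv_pos.2 hρ
      linarith
    · rw [if_neg hp, add_zero, ← one_div, le_div_iff₀ hρ]
      exact card_pairCells_fiber_mul_le hf hR hρ hA hi hp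
  refine (Finset.sum_le_sum hfib).trans ?_
  rw [Finset.sum_add_distrib, Finset.sum_ite_mem, Finset.sum_const, Finset.sum_const,
    nsmul_eq_mul, nsmul_eq_mul]
  have : ((pairCells R t A ∩ E).card : ℝ) ≤ E.card := by
    exact_mod_cast Finset.card_le_card Finset.inter_subset_right
  nlinarith [(Nat.cast_nonneg R : (0 : ℝ) ≤ R)]

/-- The number of cells which meet a set on which `f` is convex. -/
theorem card_cells_le {f : ℝ → ℝ} {ρ C : ℝ} (hf : FewTangents R ρ f) (hR : 0 < R)
    (hρ : 0 < ρ) (hρ1 : ρ ≤ 1) (hC : ∀ u v : ℝ, u < v → |(f v - f u) / (v - u)| ≤ C)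
    (hA : A ⊆ Icc 0 1) (hcv : RestrictionConvex f A) (t : ℕ) :
    ((cells R t A).card : ℝ) ≤ (2 + R * (2 + 2 * C * R ^ 2)) * (t + 1) ^ 2 * ρ⁻¹ ^ t := by
  classical
  have hC0 : 0 ≤ C := (abs_nonneg _).trans (hC 0 1 one_pos)
  have hRR : (0 : ℝ) < R := by exact_mod_cast hR
  have hκ : 1 ≤ ρ⁻¹ := (one_le_inv₀ hρ).2 hρ1
  set D := 2 + 2 * C * R ^ 2 with hD
  have hD0 : 0 ≤ D := by positivity
  have hE : ∀ t, R * ((steepCells R t A f (ρ ^ t * (ρ / R))).card : ℝ)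
      ≤ 2 * C * R ^ 2 * ρ⁻¹ ^ (t + 1) := by
    intro t
    have h := card_steepCells_mul_le (ε := ρ ^ t * (ρ / R)) hcv hR hC t
    have h2 : ((steepCells R t A f (ρ ^ t * (ρ / R))).card : ℝ) ≤ 2 * C / (ρ ^ t * (ρ / R)) := by
      rwa [le_div_iff₀ (by positivity)]
    calc _ ≤ R * (2 * C / (ρ ^ t * (ρ / R))) := by gcongr
      _ = _ := by rw [inv_pow, pow_succ]; field_simp; ring
  have h2 : ∀ t : ℕ, ((pairCells R t A).card : ℝ) ≤ D * (t + 1) * ρ⁻¹ ^ t := by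
    intro t
    induction t with
    | zero =>
      have h1 : (pairCells R 0 A).card ≤ 2 := (Finset.card_filter_le _ _).trans (by simp)
      have h1' : ((pairCells R 0 A).card : ℝ) ≤ 2 := by exact_mod_cast h1
      have : (0 : ℝ) ≤ 2 * C * R ^ 2 := by positivity
      rw [hD]; push_cast; simp only [pow_zero]; linarith
    | succ t ih =>
      refine (card_pairCells_succ_le hf hR hρ hA t).trans ?_
      calc _ ≤ 2 * C * R ^ 2 * ρ⁻¹ ^ (t + 1) + ρ⁻¹ * (D * (t + 1) * ρ⁻¹ ^ t) := by
            refine add_le_add (hE t) ?_; gcongr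
        _ ≤ D * ρ⁻¹ ^ (t + 1) + ρ⁻¹ * (D * (t + 1) * ρ⁻¹ ^ t) := by
            gcongr; rw [hD]; linarith
        _ = _ := by push_cast; ring
  induction t with
  | zero =>
    have h1 : (cells R 0 A).card ≤ 2 := (Finset.card_filter_le _ _).trans (by simp)
    have h1' : ((cells R 0 A).card : ℝ) ≤ 2 := by exact_mod_cast h1
    have : (0 : ℝ) ≤ R * D := by positivity
    push_cast; simp only [pow_zero]; linarith
  | succ t ih =>
    have h1 : ((cells R (t + 1) A).card : ℝ) ≤ (cells R t A).card + R * (pairCells R t A).card := by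
      exact_mod_cast card_cells_succ_le hR hA t
    have hp : 0 ≤ ρ⁻¹ ^ t := by positivity
    calc _ ≤ _ := h1
      _ ≤ (2 + R * D) * (t + 1) ^ 2 * ρ⁻¹ ^ t + R * (D * (t + 1) * ρ⁻¹ ^ t) := by
          gcongr; exact h2 t
      _ ≤ (2 + R * D) * (t + 1) ^ 2 * ρ⁻¹ ^ t + (2 + R * D) * (t + 1) * ρ⁻¹ ^ t := by
          have : R * (D * (t + 1) * ρ⁻¹ ^ t) = R * D * ((t + 1) * ρ⁻¹ ^ t) := by ring
          rw [this, mul_assoc _ _ (ρ⁻¹ ^ t)]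
          have : (0 : ℝ) ≤ (t + 1) * ρ⁻¹ ^ t := by positivity
          nlinarith
      _ ≤ (2 + R * D) * (t + 2) ^ 2 * ρ⁻¹ ^ t := by
          have h0 : (0 : ℝ) ≤ (2 + R * D) * ρ⁻¹ ^ t := by positivity
          have h3 : ((t : ℝ) + 1) ^ 2 + (t + 1) ≤ (t + 2) ^ 2 := by
            nlinarith [(Nat.cast_nonneg t : (0 : ℝ) ≤ t)]
          nlinarith
      _ ≤ (2 + R * D) * (t + 2) ^ 2 * ρ⁻¹ ^ (t + 1) := by
          gcongr
          omega
      _ = _ := by push_cast; ring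

end Cells

lemma gridCount_le {N R k t : ℕ} {A : Set ℝ} (hN : 0 < N) (hR : 0 < R) (hA : A ⊆ Icc 0 1)
    (hNR : N ^ k ≤ R ^ t) : gridCount N k A ≤ 2 * (cells R t A).card := by
  have hNk : (0 : ℝ) < (N : ℝ) ^ k := pow_pos (by exact_mod_cast hN) k
  have hRt : (0 : ℝ) < (R : ℝ) ^ t := pow_pos (by exact_mod_cast hR) t
  set γ : ℝ := (N : ℝ) ^ k / (R : ℝ) ^ t with hγ
  have hγ0 : 0 < γ := by positivity
  have hγ1 : γ ≤ 1 := div_le_one_of_le₀ (by exact_mod_cast hNR) hRt.le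
  set F : Finset ℤ := (cells R t A ×ˢ Finset.range 2).image
    fun p : ℕ × ℕ => ⌈(p.1 : ℝ) * γ⌉ + (p.2 : ℤ) with hF
  have hsub : {j : ℤ | (A ∩ Icc (((j : ℝ) - 1) / (N : ℝ) ^ k) ((j : ℝ) / (N : ℝ) ^ k)).Nonempty}
      ⊆ (F : Set ℤ) := by
    rintro j ⟨x, hx, hx1, hx2⟩
    rw [div_le_iff₀ hNk] at hx1
    rw [le_div_iff₀ hNk] at hx2
    set i := ⌊x * (R : ℝ) ^ t⌋₊ with hi
    obtain ⟨h1, h2⟩ := floor_bounds hR hA hx hi.symm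
    have e : x * (R : ℝ) ^ t * γ = x * (N : ℝ) ^ k := by rw [hγ]; field_simp
    have h3 : (i : ℝ) * γ ≤ x * (N : ℝ) ^ k := by rw [← e]; gcongr
    have h4 : x * (N : ℝ) ^ k < i * γ + 1 := by
      calc x * (N : ℝ) ^ k = x * (R : ℝ) ^ t * γ := e.symm
        _ < (i + 1) * γ := by gcongr
        _ ≤ i * γ + 1 := by linarith
    have h5 : ⌈(i : ℝ) * γ⌉ ≤ j := Int.ceil_le.2 (h3.trans hx2)
    have h6 : j < ⌈(i : ℝ) * γ⌉ + 2 := by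
      have := Int.le_ceil ((i : ℝ) * γ)
      have : (j : ℝ) < (⌈(i : ℝ) * γ⌉ : ℝ) + 2 := by linarith
      exact_mod_cast this
    rw [Finset.mem_coe, hF, Finset.mem_image]
    refine ⟨(i, (j - ⌈(i : ℝ) * γ⌉).toNat), ?_, ?_⟩
    · rw [Finset.mem_product, Finset.mem_range]
      refine ⟨?_, by dsimp only; omega⟩
      simp only [cells, Finset.mem_filter, Finset.mem_range]
      exact ⟨floor_le_pow hA t hx, x, hx, hi.symm⟩
    · dsimp only; omega
  unfold gridCount
  calc _ ≤ (F : Set ℤ).ncard := Set.ncard_le_ncard hsub F.finite_toSet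
    _ = F.card := Set.ncard_coe_finset F
    _ ≤ _ := Finset.card_image_le
    _ = 2 * (cells R t A).card := by rw [Finset.card_product, Finset.card_range, mul_comm]

lemma exists_pow_between {N R : ℕ} (hN : 2 ≤ N) (hR : 2 ≤ R) (k : ℕ) :
    ∃ t : ℕ, N ^ k ≤ R ^ t ∧ R ^ t ≤ R * N ^ k ∧ t ≤ N * k := by
  refine ⟨Nat.clog R (N ^ k), Nat.le_pow_clog hR _, ?_, ?_⟩
  · rcases Nat.eq_zero_or_pos k with rfl | hk
    · simpa using by omega
    · have h1 : 1 < N ^ k := Nat.one_lt_pow hk.ne' hN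
      have h2 := Nat.pow_pred_clog_lt_self hR h1
      have h3 : 0 < Nat.clog R (N ^ k) := Nat.clog_pos hR h1
      calc R ^ Nat.clog R (N ^ k) = R * R ^ (Nat.clog R (N ^ k)).pred := by
            rw [← pow_succ', ← Nat.succ_eq_add_one, Nat.succ_pred_eq_of_pos h3]
        _ ≤ R * N ^ k := by gcongr
  · refine Nat.clog_le_of_le_pow ?_
    calc N ^ k ≤ (2 ^ N) ^ k := by gcongr; exact Nat.lt_two_pow_self.le
      _ = 2 ^ (N * k) := by rw [pow_mul]
      _ ≤ R ^ (N * k) := by gcongr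

lemma tendsto_dim_bound {N : ℕ} (hN : 2 ≤ N) (α B : ℝ) :
    Tendsto (fun k : ℕ => (Real.log B / Real.log N) / (k : ℝ)
      + 4 * N / Real.log N * (Real.log ((N * k + 1 : ℕ) : ℝ) / ((N * k + 1 : ℕ) : ℝ)) + α)
      atTop (nhds α) := by
  have h1 : Tendsto (fun k : ℕ => (Real.log B / Real.log N) / (k : ℝ)) atTop (nhds 0) :=
    tendsto_const_div_atTop_nhds_zero_nat _
  have hx : Tendsto (fun k : ℕ => ((N * k + 1 : ℕ) : ℝ)) atTop atTop := by
    refine tendsto_natCast_atTop_atTop.comp (tendsto_atTop_mono (fun k => ?_) tendsto_id)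
    simp only [id]
    nlinarith
  have h2 := (Real.isLittleO_log_id_atTop.tendsto_div_nhds_zero.comp hx).const_mul
    (4 * N / Real.log N)
  simpa using (h1.add h2).add_const α

/-- A set which meets at most `D (t+1)^2 R^(α t)` cells of each level `t` has upper Minkowski
dimension at most `α`. -/
lemma upperMinkowskiDim_le {N R : ℕ} {A : Set ℝ} {α D : ℝ} (hN : 2 ≤ N) (hR : 2 ≤ R)
    (hα : 0 ≤ α) (hD : 1 ≤ D) (hA : A ⊆ Icc 0 1)
    (hcells : ∀ t : ℕ, ((cells R t A).card : ℝ) ≤ D * (t + 1) ^ 2 * ((R : ℝ) ^ α) ^ t) :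
    upperMinkowskiDim N A ≤ (α : EReal) := by
  have hNR : (2 : ℝ) ≤ N := by exact_mod_cast hN
  have hRR : (2 : ℝ) ≤ R := by exact_mod_cast hR
  have hRα : 1 ≤ (R : ℝ) ^ α := Real.one_le_rpow (by linarith) hα
  set B := 2 * D * (R : ℝ) ^ α with hB
  have hB1 : 1 ≤ B := by rw [hB]; nlinarith
  have hlogN : 0 < Real.log N := Real.log_pos (by linarith)
  have hgrid : ∀ k : ℕ, (gridCount N k A : ℝ)
      ≤ B * ((N * k + 1 : ℕ) : ℝ) ^ 2 * ((N : ℝ) ^ k) ^ α := by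
    intro k
    obtain ⟨t, ht1, ht2, ht3⟩ := exists_pow_between hN hR k
    have h1 : (gridCount N k A : ℝ) ≤ 2 * (cells R t A).card := by
      exact_mod_cast gridCount_le (by omega) (by omega) hA ht1
    have h2 : ((R : ℝ) ^ α) ^ t ≤ (R : ℝ) ^ α * ((N : ℝ) ^ k) ^ α := by
      rw [← Real.rpow_natCast, ← Real.rpow_mul (by positivity), mul_comm α,
        Real.rpow_mul (by positivity), Real.rpow_natCast, ← Real.mul_rpow (by positivity)
        (by positivity)]
      exact Real.rpow_le_rpow (by positivity) (by exact_mod_cast ht2) hα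
    have h3 : (t + 1 : ℝ) ≤ ((N * k + 1 : ℕ) : ℝ) := by exact_mod_cast Nat.succ_le_succ ht3
    calc _ ≤ 2 * (D * (t + 1) ^ 2 * ((R : ℝ) ^ α) ^ t) := by linarith [hcells t]
      _ ≤ 2 * (D * ((N * k + 1 : ℕ) : ℝ) ^ 2 * ((R : ℝ) ^ α * ((N : ℝ) ^ k) ^ α)) := by gcongr
      _ = _ := by rw [hB]; ring
  unfold upperMinkowskiDim
  have htend := (continuous_coe_real_ereal.tendsto α).comp (tendsto_dim_bound hN α B)
  rw [← htend.limsup_eq]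
  refine limsup_le_limsup ?_
  filter_upwards [eventually_ge_atTop 1] with k hk
  simp only [Function.comp]
  rw [EReal.coe_le_coe_iff]
  have hkR : (1 : ℝ) ≤ k := by exact_mod_cast hk
  set X : ℝ := ((N * k + 1 : ℕ) : ℝ) with hX
  have hX1 : 1 ≤ X := by rw [hX]; push_cast; nlinarith
  have hNk : (0 : ℝ) < (N : ℝ) ^ k := by positivity
  have hlog : Real.log (gridCount N k A)
      ≤ Real.log B + 2 * Real.log X + α * (k * Real.log N) := by
    have e : Real.log (B * X ^ 2 * ((N : ℝ) ^ k) ^ α)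
        = Real.log B + 2 * Real.log X + α * (k * Real.log N) := by
      rw [Real.log_mul (by positivity) (by positivity), Real.log_mul (by positivity)
        (by positivity), Real.log_pow, Real.log_rpow hNk, Real.log_pow]
      push_cast; ring
    rw [← e]
    rcases Nat.eq_zero_or_pos (gridCount N k A) with h0 | hpos
    · rw [h0, e, Nat.cast_zero, Real.log_zero]
      have := Real.log_nonneg hB1
      have := Real.log_nonneg hX1
      positivity
    · exact Real.log_le_log (by exact_mod_cast hpos) (hgrid k)
  have hden : 0 < k * Real.log N := by positivity
  rw [div_le_iff₀ hden]
  have hlogX := Real.log_nonneg hX1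
  have hXk : X ≤ 2 * N * k := by rw [hX]; push_cast; nlinarith
  have h1 : 2 * Real.log X ≤ 4 * N / Real.log N * (Real.log X / X) * (k * Real.log N) := by
    have e : 4 * N / Real.log N * (Real.log X / X) * (k * Real.log N)
        = 2 * Real.log X * (2 * N * k / X) := by
      have : X ≠ 0 := by positivity
      field_simp
      ring
    rw [e]
    exact le_mul_of_one_le_right (by positivity) ((one_le_div (by positivity)).2 hXk)
  have h2 : Real.log B / Real.log N / k * (k * Real.log N) = Real.log B := by
    field_simp
  rw [add_mul, add_mul, h2]
  linarith

lemma RestrictionConcave.neg {f : ℝ → ℝ} {A : Set ℝ} (hf : RestrictionConcave f A) :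
    RestrictionConvex (fun x => -f x) A := by
  intro x hx y hy z hz hxy hyz
  have := hf x hx y hy z hz hxy hyz
  linarith

theorem theorem3p1 (α : ℝ) (hα₀ : 0 < α) (hα₁ : α < 1) :
    ∃ f : ℝ → ℝ, DifferentiableHolderUnit (1 + α) f ∧
      ∀ N : ℕ, 2 ≤ N → ∀ A : Set ℝ, A ⊆ Icc 0 1 → (α : EReal) < upperMinkowskiDim N A →
        ¬ RestrictionConvex f A ∧ ¬ RestrictionConcave f A := by
  obtain ⟨R, ρ, C, f, f', hR, hρ, hder, hbd, hhol, hfew⟩ := exists_function_few_tangents hα₀ hα₁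
  have hR0 : 0 < R := by omega
  have hRR : (1 : ℝ) ≤ R := by exact_mod_cast hR0
  have hρ0 : 0 < ρ := by rw [hρ]; positivity
  have hρ1 : ρ ≤ 1 := by
    rw [hρ]; exact Real.rpow_le_one_of_one_le_of_nonpos hRR (by linarith)
  have hρinv : ρ⁻¹ = (R : ℝ) ^ α := by rw [hρ, Real.rpow_neg (by linarith), inv_inv]
  have hC0 : 0 ≤ C := (abs_nonneg _).trans (hbd 0)
  have hchord : ∀ u v : ℝ, u < v → |(f v - f u) / (v - u)| ≤ C := by
    intro u v huv
    obtain ⟨w, -, hw⟩ := exists_hasDerivAt_eq_slope f f' huv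
      (fun z _ => (hder z).continuousAt.continuousWithinAt) fun z _ => hder z
    rw [← hw]; exact hbd w
  have hdim : ∀ g : ℝ → ℝ, FewTangents R ρ g →
      (∀ u v : ℝ, u < v → |(g v - g u) / (v - u)| ≤ C) → ∀ N : ℕ, 2 ≤ N → ∀ A : Set ℝ,
      A ⊆ Icc 0 1 → RestrictionConvex g A → upperMinkowskiDim N A ≤ (α : EReal) := by
    intro g hg hgC N hN A hA hcv
    refine upperMinkowskiDim_le hN hR hα₀.le (D := 2 + R * (2 + 2 * C * R ^ 2)) ?_ hA fun t => ?_
    · have : (0 : ℝ) ≤ R * (2 + 2 * C * R ^ 2) := by positivity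
      linarith
    · rw [← hρinv]
      exact card_cells_le hg hR0 hρ0 hρ1 hgC hA hcv t
  refine ⟨f, ⟨fun x _ => (hder x).differentiableAt.differentiableWithinAt, C, ?_⟩, ?_⟩
  · intro x hx y hy hxy
    have hd : ∀ z ∈ Icc (0 : ℝ) 1, derivWithin f (Icc 0 1) z = f' z := fun z hz =>
      (hder z).hasDerivWithinAt.derivWithin (uniqueDiffOn_Icc one_pos z hz)
    rw [hd x hx, hd y hy, add_sub_cancel_left,
      div_le_iff₀ (Real.rpow_pos_of_pos (abs_pos.2 (sub_ne_zero.2 hxy)) _)]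
    refine hhol x y hxy (abs_le.2 ⟨?_, ?_⟩) <;> linarith [hx.1, hx.2, hy.1, hy.2]
  · intro N hN A hA hlt
    refine ⟨fun hcv => absurd (hdim f hfew hchord N hN A hA hcv) (not_le.2 hlt), fun hcc => ?_⟩
    refine absurd (hdim (fun x => -f x) hfew.neg (fun u v huv => ?_) N hN A hA hcc.neg)
      (not_le.2 hlt)
    have e : (-f v - -f u) / (v - u) = -((f v - f u) / (v - u)) := by ring
    rw [e, abs_neg]
    exact hchord u v huv
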